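/- All graphs are finite, simple and connected, and every edge has length $1$. A graph $G$ is regarded as a geodesic metric space: each edge is identified with the interval $[0,1]$, the points of $G$ are the vertices and the interior points of the edges, and the distance is the length of a shortest path. A geodesic triangle $T$ in $G$ is the union of three geodesics joining three points of $G$ pairwise; $\delta(T)$ is the infimum of all $\delta\ge 0$ such that each side of $T$ is contained in the (closed) $\delta$-neighbourhood of the union of the two other sides; and $\delta(G)=\sup_T\delta(T)$ over all geodesic triangles $T$ in $G$. Let $\mathcal G(n,m)$ be the set of graphs with $n$ vertices and $m$ edges, and $B(n,m)=\max\{\delta(G) : G\in\mathcal G(n,m)\}$. For integers $r$, $n$ with $2\le r\le n/2$ put $$\Delta_r=\min\Big\{\sum_{t=2}^{r}k_t\sum_{s=0}^{t-2}k_s \;:\; k_0=1,\ k_j\ge 2\ (1\le j\le r-1),\ k_r\ge 1,\ \sum_{j=0}^{r}k_j=n\Big\},$$ where the $k_j$ are real numbers, and $M(n,r)=\binom n2-\Delta_r$; put also $M(n,1)=n(n-1)/2$. Then: (1) If $n\ge 1$ and $m=n-1$, then $B(n,m)=0$. (2) If $n\ge 3$, $n\le m\le n+3$ and $m\le\binom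 n2$, then $B(n,m)=n/4$. (3) If $2\le r\le n/2$ and $M(n,r)<m\le M(n,r-1)$, then $B(n,m)\le r/2$. (4) The minimum $\Delta_r$ exists whenever $2\le r\le n/2$, and it is explicitly $\Delta_2=1$, $\Delta_3=n-1$, and $\Delta_r=2n(r-3)-2r^2+6r+5$ for $r\ge 4$. In (1), (2) and (3) the set $\mathcal G(n,m)$ is non-empty and the maximum defining $B(n,m)$ is attained. -/

import Mathlib

/-! ### Geodesic triangles and the sharp hyperbolicity constant (Rips condition) -/

section Hyperbolicity

variable {X : Type*} [MetricSpace X]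

/-- `S` is (the image of) a geodesic joining `x` and `y`. -/
def IsGeodesicSegment (S : Set X) (x y : X) : Prop :=
  ∃ γ : ℝ → X, γ 0 = x ∧ γ (dist x y) = y ∧
    (∀ s ∈ Set.Icc 0 (dist x y), ∀ t ∈ Set.Icc 0 (dist x y), dist (γ s) (γ t) = |s - t|) ∧
    S = γ '' Set.Icc 0 (dist x y)

/-- `A`, `B`, `C` are the three sides of a geodesic triangle. -/
def IsGeodesicTriangle (A B C : Set X) : Prop :=
  ∃ x y z : X, IsGeodesicSegment A x y ∧ IsGeodesicSegment B y z ∧ IsGeodesicSegment C z x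

/-- Every side is within distance `δ` of the union of the two others. -/
def IsThinTriangle (δ : ℝ) (A B C : Set X) : Prop :=
  (∀ p ∈ A, Metric.infDist p (B ∪ C) ≤ δ) ∧
  (∀ p ∈ B, Metric.infDist p (C ∪ A) ≤ δ) ∧
  (∀ p ∈ C, Metric.infDist p (A ∪ B) ≤ δ)

/-- The sharp thin constant of a triangle with sides `A`, `B`, `C`. -/
noncomputable def thinConstant (A B C : Set X) : ℝ :=
  sInf {δ : ℝ | 0 ≤ δ ∧ IsThinTriangle δ A B C}

variable (X) in
/-- The sharp hyperbolicity constant: the supremum of the thin constants of all geodesic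
triangles. (It is only used for spaces of finite diameter, where these constants are bounded.) -/
noncomputable def hyperbolicityConstant : ℝ :=
  sSup {d : ℝ | ∃ A B C : Set X, IsGeodesicTriangle A B C ∧ d = thinConstant A B C}

end Hyperbolicity

/-! ### A finite connected simple graph as a metric graph with edges of length one -/

section MetricGraph

variable {V : Type*} [Fintype V]

/-- The points of the metric graph, in barycentric coordinates: weights concentrated on
a vertex or on the two endpoints of an edge. The point of the edge `[u, v]` at distance `t`
from `u` has weight `1 - t` at `u` and `t` at `v`. -/
@[ext]
structure MetricGraph (G : SimpleGraph V) (hG : G.Connected) where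
  coord : V → ℝ
  nonneg : ∀ v, 0 ≤ coord v
  sum_eq_one : ∑ v, coord v = 1
  on_edge : ∃ u v, (u = v ∨ G.Adj u v) ∧ ∀ w, w ≠ u → w ≠ v → coord w = 0

namespace MetricGraph

variable {G : SimpleGraph V} {hG : G.Connected}

/-- Both points lie on one closed edge. -/
def SameEdge (x y : MetricGraph G hG) : Prop :=
  ∃ u v, G.Adj u v ∧ ∀ w, w ≠ u → w ≠ v → x.coord w = 0 ∧ y.coord w = 0

/-- The lengths of the candidates for a shortest path from `x` to `y`: leave `x` through an
endpoint `u` of its edge, follow a shortest path in the graph to an endpoint `v` of the edge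
of `y`, and continue to `y`; or, if `x` and `y` lie on a common edge, go straight along it. -/
def routeLengths (x y : MetricGraph G hG) : Set ℝ :=
  {l | (∃ u v, x.coord u ≠ 0 ∧ y.coord v ≠ 0 ∧
          l = (1 - x.coord u) + (G.dist u v : ℝ) + (1 - y.coord v)) ∨
       (SameEdge x y ∧ l = (∑ w, |x.coord w - y.coord w|) / 2)}

noncomputable instance : Dist (MetricGraph G hG) := ⟨fun x y => sInf (routeLengths x y)⟩

theorem dist_def (x y : MetricGraph G hG) : dist x y = sInf (routeLengths x y) := rfl

theorem coord_le_one (x : MetricGraph G hG) (u : V) : x.coord u ≤ 1 := by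
  rw [← x.sum_eq_one]
  exact Finset.single_le_sum (fun v _ => x.nonneg v) (Finset.mem_univ u)

theorem exists_coord_ne_zero (x : MetricGraph G hG) : ∃ u, x.coord u ≠ 0 := by
  by_contra! h
  have := x.sum_eq_one
  simp [h] at this

theorem routeLengths_finite (x y : MetricGraph G hG) : (routeLengths x y).Finite := by
  have h1 : (Set.range fun p : V × V =>
      (1 - x.coord p.1) + (G.dist p.1 p.2 : ℝ) + (1 - y.coord p.2)).Finite := Set.finite_range _
  refine (h1.union (Set.finite_singleton ((∑ w, |x.coord w - y.coord w|) / 2))).subset ?_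
  rintro l (⟨u, v, -, -, rfl⟩ | ⟨-, rfl⟩)
  · exact Or.inl ⟨(u, v), rfl⟩
  · exact Or.inr rfl

theorem routeLengths_nonempty (x y : MetricGraph G hG) : (routeLengths x y).Nonempty := by
  obtain ⟨u, hu⟩ := x.exists_coord_ne_zero
  obtain ⟨v, hv⟩ := y.exists_coord_ne_zero
  exact ⟨_, Or.inl ⟨u, v, hu, hv, rfl⟩⟩

theorem dist_mem (x y : MetricGraph G hG) : dist x y ∈ routeLengths x y :=
  (routeLengths_nonempty x y).csInf_mem (routeLengths_finite x y)

theorem dist_le {x y : MetricGraph G hG} {l : ℝ} (h : l ∈ routeLengths x y) : dist x y ≤ l :=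
  csInf_le (routeLengths_finite x y).bddBelow h

theorem SameEdge.symm {x y : MetricGraph G hG} (h : SameEdge x y) : SameEdge y x := by
  obtain ⟨u, v, huv, h⟩ := h
  exact ⟨u, v, huv, fun w h1 h2 => (h w h1 h2).symm⟩

theorem routeLengths_comm (x y : MetricGraph G hG) : routeLengths x y ⊆ routeLengths y x := by
  rintro l (⟨u, v, hu, hv, rfl⟩ | ⟨h, rfl⟩)
  · exact Or.inl ⟨v, u, hv, hu, by rw [G.dist_comm]; ring⟩
  · exact Or.inr ⟨h.symm, by simp only [abs_sub_comm]⟩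

theorem sum_pair (x : MetricGraph G hG) {u v : V} (huv : u ≠ v)
    (h : ∀ w, w ≠ u → w ≠ v → x.coord w = 0) : x.coord u + x.coord v = 1 := by
  classical
  rw [← x.sum_eq_one, ← Finset.sum_pair (f := x.coord) huv]
  refine Finset.sum_subset (Finset.subset_univ _) fun w _ hw => ?_
  simp only [Finset.mem_insert, Finset.mem_singleton, not_or] at hw
  exact h w hw.1 hw.2

theorem eq_zero_of_eq_one (x : MetricGraph G hG) {u : V} (hu : x.coord u = 1) (w : V)
    (hw : w ≠ u) : x.coord w = 0 := by
  classical
  have h1 := Finset.sum_le_sum_of_subset_of_nonneg (Finset.subset_univ {w, u})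
    (fun v _ _ => x.nonneg v)
  rw [x.sum_eq_one, Finset.sum_pair hw, hu] at h1
  exact le_antisymm (by linarith) (x.nonneg w)

theorem ext_of_eq_one {x y : MetricGraph G hG} {u : V} (hx : x.coord u = 1)
    (hy : y.coord u = 1) : x = y := by
  ext w
  by_cases hw : w = u
  · rw [hw, hx, hy]
  · rw [x.eq_zero_of_eq_one hx w hw, y.eq_zero_of_eq_one hy w hw]

/-- Two points of one closed edge: half the `ℓ¹` distance of the coordinates. -/
theorem half_sum (x y : MetricGraph G hG) {u v : V} (huv : u ≠ v)
    (h : ∀ w, w ≠ u → w ≠ v → x.coord w = 0 ∧ y.coord w = 0) :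
    (∑ w, |x.coord w - y.coord w|) / 2 = |x.coord u - y.coord u| := by
  classical
  have hs : ∑ w, |x.coord w - y.coord w| = |x.coord u - y.coord u| + |x.coord v - y.coord v| := by
    rw [← Finset.sum_pair (f := fun w => |x.coord w - y.coord w|) huv]
    refine (Finset.sum_subset (Finset.subset_univ _) fun w _ hw => ?_).symm
    simp only [Finset.mem_insert, Finset.mem_singleton, not_or] at hw
    simp [h w hw.1 hw.2]
  have hx := x.sum_pair huv fun w a b => (h w a b).1
  have hy := y.sum_pair huv fun w a b => (h w a b).2
  have : |x.coord v - y.coord v| = |x.coord u - y.coord u| := by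
    rw [← abs_neg]; congr 1; linarith
  rw [hs, this]; ring

/-- The graph distance of two vertices in the support of a point. -/
theorem dist_le_of_support (y : MetricGraph G hG) {u v : V} (hu : y.coord u ≠ 0)
    (hv : y.coord v ≠ 0) : (G.dist u v : ℝ) ≤ (1 - y.coord u) + (1 - y.coord v) := by
  by_cases huv : u = v
  · subst huv
    have := y.coord_le_one u
    rw [SimpleGraph.dist_self]; push_cast; linarith
  · obtain ⟨a, b, hab, h⟩ := y.on_edge
    have hua : u = a ∨ u = b := by by_contra! hc; exact hu (h u hc.1 hc.2)
    have hva : v = a ∨ v = b := by by_contra! hc; exact hv (h v hc.1 hc.2)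
    have hne : a ≠ b := by rintro rfl; simp_all
    have hadj : G.Adj a b := hab.resolve_left hne
    have hs := y.sum_pair hne h
    have h1 : G.dist a b = 1 := SimpleGraph.dist_eq_one_iff_adj.2 hadj
    rcases hua with rfl | rfl <;> rcases hva with rfl | rfl
    · exact absurd rfl huv
    · rw [h1]; push_cast; linarith
    · rw [G.dist_comm, h1]; push_cast; linarith
    · exact absurd rfl huv

/-- From a point `x` on the same edge as `y`, a vertex `v` in the support of `y` is reached
through the support of `x`. -/
theorem exists_support_of_sameEdge {x y : MetricGraph G hG} (h : SameEdge x y) {v : V}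
    (hv : y.coord v ≠ 0) : ∃ u, x.coord u ≠ 0 ∧ (1 - x.coord u) + (G.dist u v : ℝ) ≤
      (∑ w, |x.coord w - y.coord w|) / 2 + (1 - y.coord v) := by
  obtain ⟨a, b, hab, h⟩ := h
  wlog hva : v = a generalizing a b
  · refine this b a hab.symm (fun w h1 h2 => h w h2 h1) ?_
    by_contra hvb
    exact hv (h v hva hvb).2
  subst hva
  have hx := x.sum_pair hab.ne fun w p q => (h w p q).1
  rw [half_sum x y hab.ne h]
  have h2 := neg_abs_le (x.coord v - y.coord v)
  by_cases hxv : x.coord v = 0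
  · refine ⟨b, by rw [hxv] at hx; linarith, ?_⟩
    have h1 : G.dist b v = 1 := SimpleGraph.dist_eq_one_iff_adj.2 hab.symm
    rw [h1]; push_cast; linarith
  · refine ⟨v, hxv, ?_⟩
    rw [SimpleGraph.dist_self]; push_cast; linarith

theorem via_triangle {x z : MetricGraph G hG} (y : MetricGraph G hG) {u v u' v' : V}
    (hu : x.coord u ≠ 0) (hv : y.coord v ≠ 0) (hu' : y.coord u' ≠ 0) (hv' : z.coord v' ≠ 0) :
    dist x z ≤ ((1 - x.coord u) + (G.dist u v : ℝ) + (1 - y.coord v)) +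
      ((1 - y.coord u') + (G.dist u' v' : ℝ) + (1 - z.coord v')) := by
  refine (dist_le (Or.inl ⟨u, v', hu, hv', rfl⟩)).trans ?_
  have h1 := y.dist_le_of_support hv hu'
  have h2 : (G.dist u v' : ℝ) ≤ G.dist u v + G.dist v v' := by
    exact_mod_cast hG.dist_triangle
  have h3 : (G.dist v v' : ℝ) ≤ G.dist v u' + G.dist u' v' := by
    exact_mod_cast hG.dist_triangle
  linarith

theorem same_via_triangle {x y z : MetricGraph G hG} (h : SameEdge x y) {u' v' : V}
    (hu' : y.coord u' ≠ 0) (hv' : z.coord v' ≠ 0) :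
    dist x z ≤ (∑ w, |x.coord w - y.coord w|) / 2 +
      ((1 - y.coord u') + (G.dist u' v' : ℝ) + (1 - z.coord v')) := by
  obtain ⟨u, hu, hle⟩ := exists_support_of_sameEdge h hu'
  refine (dist_le (Or.inl ⟨u, v', hu, hv', rfl⟩)).trans ?_
  have h2 : (G.dist u v' : ℝ) ≤ G.dist u u' + G.dist u' v' := by
    exact_mod_cast hG.dist_triangle
  linarith

protected theorem dist_comm' (x y : MetricGraph G hG) : dist x y = dist y x := by
  rw [dist_def, dist_def, Set.Subset.antisymm (routeLengths_comm x y) (routeLengths_comm y x)]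

theorem same_same_triangle {x y z : MetricGraph G hG} (h : SameEdge x y) (h' : SameEdge y z) :
    dist x z ≤ (∑ w, |x.coord w - y.coord w|) / 2 + (∑ w, |y.coord w - z.coord w|) / 2 := by
  by_cases hxz : SameEdge x z
  · refine (dist_le (Or.inr ⟨hxz, rfl⟩)).trans ?_
    have : ∑ w, |x.coord w - z.coord w| ≤
        ∑ w, |x.coord w - y.coord w| + ∑ w, |y.coord w - z.coord w| := by
      rw [← Finset.sum_add_distrib]
      exact Finset.sum_le_sum fun w _ => abs_sub_le _ _ _
    linarith
  · -- the two edges differ, so `y` is a vertex `c`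
    obtain ⟨c, hc⟩ : ∃ c, y.coord c = 1 := by
      obtain ⟨a, b, hab, he⟩ := h
      obtain ⟨a', b', hab', he'⟩ := h'
      have hy := y.sum_pair hab.ne fun w p q => (he w p q).2
      by_cases ha0 : y.coord a = 0
      · exact ⟨b, by linarith⟩
      by_cases hb0 : y.coord b = 0
      · exact ⟨a, by linarith⟩
      exfalso
      have ha : a = a' ∨ a = b' := by by_contra! hn; exact ha0 (he' a hn.1 hn.2).1
      have hb : b = a' ∨ b = b' := by by_contra! hn; exact hb0 (he' b hn.1 hn.2).1
      have hne := hab.ne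
      apply hxz
      refine ⟨a, b, hab, fun w p q => ⟨(he w p q).1, (he' w ?_ ?_).2⟩⟩
      · rintro rfl; rcases ha with rfl | rfl <;> rcases hb with rfl | rfl <;> simp_all
      · rintro rfl; rcases ha with rfl | rfl <;> rcases hb with rfl | rfl <;> simp_all
    have hc0 : y.coord c ≠ 0 := by rw [hc]; norm_num
    obtain ⟨v, hv, hle⟩ := exists_support_of_sameEdge h'.symm hc0
    have := same_via_triangle h hc0 hv
    rw [G.dist_comm] at hle
    simp only [abs_sub_comm (z.coord _)] at hle
    linarith

protected theorem dist_triangle' (x y z : MetricGraph G hG) :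
    dist x z ≤ dist x y + dist y z := by
  rcases dist_mem x y with ⟨u, v, hu, hv, e⟩ | ⟨h, e⟩ <;>
    rcases dist_mem y z with ⟨u', v', hu', hv', e'⟩ | ⟨h', e'⟩
  · rw [e, e']; exact via_triangle y hu hv hu' hv'
  · have := same_via_triangle h'.symm hv hu
    rw [MetricGraph.dist_comm', e, e', G.dist_comm (u := u) (v := v)]
    simp only [abs_sub_comm (y.coord _)]
    linarith
  · rw [e, e']; exact same_via_triangle h hu' hv'
  · rw [e, e']; exact same_same_triangle h h'

theorem dist_nonneg' (x y : MetricGraph G hG) : 0 ≤ dist x y := by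
  rcases dist_mem x y with ⟨u, v, -, -, e⟩ | ⟨-, e⟩
  · have := x.coord_le_one u
    have := y.coord_le_one v
    have : (0 : ℝ) ≤ G.dist u v := Nat.cast_nonneg _
    linarith
  · rw [e]; positivity

protected theorem dist_self' (x : MetricGraph G hG) : dist x x = 0 := by
  refine le_antisymm (dist_le ?_) (dist_nonneg' x x)
  obtain ⟨u, v, huv | huv, h⟩ := x.on_edge
  · subst huv
    have hu : x.coord u = 1 := by
      rw [← x.sum_eq_one]
      exact (Fintype.sum_eq_single u fun w hw => h w hw hw).symm
    exact Or.inl ⟨u, u, by simp [hu], by simp [hu], by simp [hu]⟩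
  · exact Or.inr ⟨⟨u, v, huv, fun w p q => ⟨h w p q, h w p q⟩⟩, by simp⟩

protected theorem eq_of_dist_eq_zero' {x y : MetricGraph G hG} (h0 : dist x y = 0) : x = y := by
  rcases dist_mem x y with ⟨u, v, -, -, e⟩ | ⟨⟨u, v, huv, h⟩, e⟩
  · have h1 := x.coord_le_one u
    have h2 := y.coord_le_one v
    have h3 : (0 : ℝ) ≤ G.dist u v := Nat.cast_nonneg _
    rw [h0] at e
    have h4 : (G.dist u v : ℝ) = 0 := by linarith
    have huv : u = v := hG.dist_eq_zero_iff.1 (by exact_mod_cast h4)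
    subst huv
    exact ext_of_eq_one (u := u) (by linarith) (by linarith)
  · rw [h0] at e
    have hs : ∑ w, |x.coord w - y.coord w| = 0 := by linarith
    ext w
    have := (Finset.sum_eq_zero_iff_of_nonneg fun w _ => abs_nonneg _).1 hs w (Finset.mem_univ w)
    exact sub_eq_zero.1 (abs_eq_zero.1 this)

/-- The shortest-path metric of the metric graph. -/
noncomputable instance : MetricSpace (MetricGraph G hG) where
  dist_self := MetricGraph.dist_self'
  dist_comm := MetricGraph.dist_comm'
  dist_triangle := MetricGraph.dist_triangle'
  eq_of_dist_eq_zero := MetricGraph.eq_of_dist_eq_zero'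

end MetricGraph

end MetricGraph

/-! ### The maximal hyperbolicity constant `B(n, m)` and the numbers `M(n, r)` -/

/-- The values `δ(G)`, for `G` a connected simple graph with `n` vertices and `m` edges. -/
def hyperbolicityValues (n m : ℕ) : Set ℝ :=
  {d | ∃ (G : SimpleGraph (Fin n)) (hG : G.Connected), G.edgeSet.ncard = m ∧
    d = hyperbolicityConstant (MetricGraph G hG)}

/-- `B(n, m)`, the maximum of these values. -/
noncomputable def maxHyperbolicity (n m : ℕ) : ℝ :=
  sSup (hyperbolicityValues n m)

/-- `f_r(k) = ∑_{t = 2}^{r} k_t ∑_{s = 0}^{t - 2} k_s`. -/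
def missingEdges (r : ℕ) (k : ℕ → ℝ) : ℝ :=
  ∑ t ∈ Finset.Icc 2 r, k t * ∑ s ∈ Finset.range (t - 1), k s

/-- The constraints: `k_0 = 1`, `k_j ≥ 2` for `1 ≤ j ≤ r - 1`, `k_r ≥ 1`, and
`k_0 + k_1 + ... + k_r = n`. -/
def layerSizes (n r : ℕ) : Set (ℕ → ℝ) :=
  {k | k 0 = 1 ∧ (∀ j, 1 ≤ j → j < r → 2 ≤ k j) ∧ 1 ≤ k r ∧
    ∑ j ∈ Finset.range (r + 1), k j = n}

/-- `Δ_r` (for graphs with `n` vertices), the minimum of `f_r` under these constraints. -/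
noncomputable def minMissingEdges (n r : ℕ) : ℝ :=
  sInf (missingEdges r '' layerSizes n r)

/-- `M(n, r) = n (n - 1) / 2 - Δ_r` for `r ≥ 2`, and `M(n, 1) = n (n - 1) / 2`. -/
noncomputable def edgeBound (n r : ℕ) : ℝ :=
  if r = 1 then (n : ℝ) * (n - 1) / 2 else (n.choose 2 : ℝ) - minMissingEdges n r

/-!
The constant `δ(G)` is governed by detours. If a geodesic triangle is not `c`-thin, some point
`p` of a side has distance more than `c` from the two other sides. For a radius `D > c`, the
part of the side within distance `D` of `p` is a geodesic of length `2 * D`, and its ends are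
joined, along the rest of the triangle, by a connected set that stays at distance at least `D`
from `p` (`exists_isDetour_of_lt_infDist`). All upper bounds count vertices in such a detour.
Three facts about the metric graph are used: a point at integer distance from a vertex is a
vertex, a connected set leaves an edge only through its ends, and a connected set meets every
sphere between two of its points.

* Along a detour one can go round: the geodesic and the connected set together contain at least
  `4 * D` vertices (`IsDetour.le_card`), whence `δ(G) ≤ n / 4` for all graphs.
* In a detour, the edge through a point of the geodesic is not a bridge
  (`IsDetour.not_isAcyclic`), whence `δ(G) = 0` for trees.
* If `D > r / 2`, the distance layers around a vertex near one end of the geodesic contain, up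
  to the `(r - 1)`-st, a vertex of the geodesic and a vertex of the connected set, and the
  `r`-th is not empty (`IsDetour.exists_layers`). Vertices in non-consecutive layers are not
  adjacent, so at least `f_r` of the layer sizes many edges are missing, and `m ≤ M(n, r)`.

For the equality `B(n, m) = n / 4` with `n ≤ m ≤ n + 3`, take a cycle of length `n` and a
triangle with two corners at opposite points, so that its sides are the two halves of the cycle.
Up to three chords near these corners can be added without bringing the corners closer together
or the middle of one half closer to the other half (`MetricGraph.exists_card_div_four_le`).

For the minimum of `f_r`, write the layer sizes as `1, 2, ..., 2, 1` plus non-negative excesses.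
For `r ≥ 3` each excess enters `f_r` with a coefficient at least `2 * r - 6`, and products of
excesses only help (`le_missingEdges`). For `r ≥ 4` equality holds when the whole excess is in
layer `2`. For `r = 2` and `r = 3` the minimum is found directly.
-/

/-! ### Sides of a triangle that are not thin -/

section Obstruction

variable {X : Type*} [MetricSpace X]

theorem IsGeodesicSegment.isPreconnected {S : Set X} {x y : X} (h : IsGeodesicSegment S x y) :
    IsPreconnected S := by
  obtain ⟨γ, -, -, h, rfl⟩ := h
  refine isPreconnected_Icc.image _ (LipschitzOnWith.continuousOn (K := 1) ?_)
  refine LipschitzOnWith.of_dist_le_mul fun s hs t ht => ?_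
  simp [h s hs t ht, Real.dist_eq]

theorem IsGeodesicSegment.left_mem {S : Set X} {x y : X} (h : IsGeodesicSegment S x y) :
    x ∈ S := by
  obtain ⟨γ, h0, -, -, rfl⟩ := h
  exact ⟨0, ⟨le_rfl, dist_nonneg⟩, h0⟩

theorem IsGeodesicSegment.right_mem {S : Set X} {x y : X} (h : IsGeodesicSegment S x y) :
    y ∈ S := by
  obtain ⟨γ, -, h1, -, rfl⟩ := h
  exact ⟨dist x y, ⟨dist_nonneg, le_rfl⟩, h1⟩

/-- The geodesic `γ` on `[-D, D]` has its ends in a connected set `Q` that keeps distance at least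
`D` from its midpoint `γ 0`. A geodesic triangle that is not thin contains such a detour around
a point of one of its sides. -/
structure IsDetour (D : ℝ) (γ : ℝ → X) (Q : Set X) : Prop where
  isometric : ∀ s ∈ Set.Icc (-D) D, ∀ t ∈ Set.Icc (-D) D, dist (γ s) (γ t) = |s - t|
  isPreconnected : IsPreconnected Q
  left_mem : γ (-D) ∈ Q
  right_mem : γ D ∈ Q
  le_dist : ∀ q ∈ Q, D ≤ dist (γ 0) q

theorem IsDetour.reverse {D : ℝ} {γ : ℝ → X} {Q : Set X} (h : IsDetour D γ Q) :
    IsDetour D (fun s => γ (-s)) Q where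
  isometric s hs t ht := by
    rw [h.isometric _ ⟨by linarith [hs.2], by linarith [hs.1]⟩ _
      ⟨by linarith [ht.2], by linarith [ht.1]⟩, ← abs_neg]
    congr 1; ring
  isPreconnected := h.isPreconnected
  left_mem := by simpa using h.right_mem
  right_mem := h.left_mem
  le_dist := by simpa using h.le_dist

theorem IsDetour.notMem {D : ℝ} {γ : ℝ → X} {Q : Set X} (h : IsDetour D γ Q) {s : ℝ}
    (h1 : -D < s) (h2 : s < D) : γ s ∉ Q := fun hs => by
  have := h.le_dist _ hs
  rw [h.isometric 0 ⟨by linarith, by linarith⟩ s ⟨h1.le, h2.le⟩, zero_sub, abs_neg] at this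
  exact absurd (abs_lt.2 ⟨h1, h2⟩) (not_lt.2 this)

theorem IsDetour.continuousOn {D : ℝ} {γ : ℝ → X} {Q : Set X} (h : IsDetour D γ Q) :
    ContinuousOn γ (Set.Icc (-D) D) := by
  refine LipschitzOnWith.continuousOn (K := 1) ?_
  refine LipschitzOnWith.of_dist_le_mul fun s hs t ht => ?_
  simp [h.isometric s hs t ht, Real.dist_eq]

/-- A point of a side at distance more than `c` from the two other sides is the midpoint of
a detour whose radius exceeds `c` by as little as one likes: the detour runs along the outer parts
of the side and along the two other sides. -/
theorem exists_isDetour_of_lt_infDist {A B C : Set X} {x y z : X} (hA : IsGeodesicSegment A x y)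
    (hB : IsGeodesicSegment B y z) (hC : IsGeodesicSegment C z x) {c ε : ℝ} (hc : 0 ≤ c)
    (hε : 0 < ε) {p : X} (hp : p ∈ A) (h : c < Metric.infDist p (B ∪ C)) :
    ∃ D γ Q, c < D ∧ D ≤ c + ε ∧ IsDetour (X := X) D γ Q := by
  have hBC : IsPreconnected (B ∪ C) :=
    hB.isPreconnected.union z hB.right_mem hC.left_mem hC.isPreconnected
  have hx : x ∈ B ∪ C := Or.inr hC.right_mem
  have hy : y ∈ B ∪ C := Or.inl hB.left_mem
  obtain ⟨D, hD1, hD2, hD3⟩ : ∃ D, c < D ∧ D ≤ c + ε ∧ D ≤ Metric.infDist p (B ∪ C) :=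
    ⟨min (c + ε) (Metric.infDist p (B ∪ C)), lt_min (by linarith) h, min_le_left _ _,
      min_le_right _ _⟩
  have hle : ∀ q ∈ B ∪ C, D ≤ dist p q := fun q hq => hD3.trans (Metric.infDist_le_dist_of_mem hq)
  obtain ⟨γ, h0, h1, hiso, rfl⟩ := hA
  obtain ⟨τ, hτ, rfl⟩ := hp
  set L := dist x y with hL
  have hL0 : 0 ≤ L := dist_nonneg
  have hDx : D ≤ τ := by
    have := hle x hx
    rw [← h0, hiso τ hτ 0 ⟨le_rfl, hL0⟩, sub_zero, abs_of_nonneg hτ.1] at this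
    exact this
  have hDy : D ≤ L - τ := by
    have := hle y hy
    rw [← h1, hiso τ hτ L ⟨hL0, le_rfl⟩, abs_sub_comm, abs_of_nonneg (by linarith [hτ.2])] at this
    exact this
  have hcont : ContinuousOn γ (Set.Icc 0 L) := by
    refine LipschitzOnWith.continuousOn (K := 1) (LipschitzOnWith.of_dist_le_mul ?_)
    intro s hs t ht
    simp [hiso s hs t ht, Real.dist_eq]
  have hD0 : 0 < D := by linarith
  have hP1 : IsPreconnected (γ '' Set.Icc 0 (τ - D)) :=
    isPreconnected_Icc.image _ (hcont.mono (Set.Icc_subset_Icc_right (by linarith)))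
  have hP2 : IsPreconnected (γ '' Set.Icc (τ + D) L) :=
    isPreconnected_Icc.image _ (hcont.mono (Set.Icc_subset_Icc_left (by linarith)))
  refine ⟨D, fun s => γ (τ + s), (γ '' Set.Icc 0 (τ - D) ∪ (B ∪ C)) ∪ γ '' Set.Icc (τ + D) L,
    hD1, hD2, ?_, ?_, ?_, ?_, ?_⟩
  · intro s hs t ht
    rw [hiso _ ⟨by linarith [hs.1], by linarith [hs.2]⟩ _ ⟨by linarith [ht.1], by linarith [ht.2]⟩]
    congr 1; ring
  · have hx' : x ∈ γ '' Set.Icc 0 (τ - D) := ⟨0, ⟨le_rfl, by linarith⟩, h0⟩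
    have hy' : y ∈ γ '' Set.Icc (τ + D) L := ⟨L, ⟨by linarith, le_rfl⟩, h1⟩
    exact (hP1.union x hx' hx hBC).union y (Or.inr hy) hy' hP2
  · exact Or.inl (Or.inl ⟨τ - D, ⟨by linarith, le_rfl⟩, by ring_nf⟩)
  · exact Or.inr ⟨τ + D, ⟨le_rfl, by linarith⟩, rfl⟩
  · simp only [add_zero]
    rintro q ((⟨s, hs, rfl⟩ | hq) | ⟨s, hs, rfl⟩)
    · rw [hiso τ hτ s ⟨hs.1, by linarith [hs.2]⟩, abs_of_nonneg (by linarith [hs.2])]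
      linarith [hs.2]
    · exact hle q hq
    · rw [hiso τ hτ s ⟨by linarith [hs.1], hs.2⟩, abs_sub_comm, abs_of_nonneg (by linarith [hs.1])]
      linarith [hs.1]

/-- Only the detours of radius at most `c + ε` have to be excluded. -/
theorem isThinTriangle_of_no_detour {c ε : ℝ} (hc : 0 ≤ c) (hε : 0 < ε)
    (h : ∀ (D : ℝ) (γ : ℝ → X) (Q : Set X), c < D → D ≤ c + ε → ¬ IsDetour D γ Q)
    {A B C : Set X} (hT : IsGeodesicTriangle A B C) : IsThinTriangle c A B C := by
  obtain ⟨x, y, z, hA, hB, hC⟩ := hT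
  have key : ∀ {A B C : Set X} {x y z : X}, IsGeodesicSegment A x y → IsGeodesicSegment B y z →
      IsGeodesicSegment C z x → ∀ p ∈ A, Metric.infDist p (B ∪ C) ≤ c := by
    intro A B C x y z hA hB hC p hp
    by_contra! hlt
    obtain ⟨D, γ, Q, h1, h2, h3⟩ := exists_isDetour_of_lt_infDist hA hB hC hc hε hp hlt
    exact h D γ Q h1 h2 h3
  exact ⟨key hA hB hC, key hB hC hA, key hC hA hB⟩

theorem thinConstant_le {c : ℝ} (hc : 0 ≤ c) {A B C : Set X} (h : IsThinTriangle c A B C) :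
    thinConstant A B C ≤ c :=
  csInf_le ⟨0, fun _ hd => hd.1⟩ ⟨hc, h⟩

variable (X) in
theorem hyperbolicityConstant_nonneg : 0 ≤ hyperbolicityConstant X := by
  refine Real.sSup_nonneg ?_
  rintro d ⟨A, B, C, -, rfl⟩
  exact Real.sInf_nonneg fun _ hd => hd.1

theorem hyperbolicityConstant_le_of_no_detour {c ε : ℝ} (hc : 0 ≤ c) (hε : 0 < ε)
    (h : ∀ (D : ℝ) (γ : ℝ → X) (Q : Set X), c < D → D ≤ c + ε → ¬ IsDetour D γ Q) :
    hyperbolicityConstant X ≤ c := by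
  refine Real.sSup_le ?_ hc
  rintro d ⟨A, B, C, hT, rfl⟩
  exact thinConstant_le hc (isThinTriangle_of_no_detour hc hε h hT)

/-- When all triangles are `c`-thin, a point at distance `c` from the two other sides of its
triangle shows that `c` is at most the hyperbolicity constant. -/
theorem le_hyperbolicityConstant {c : ℝ} (hc : 0 ≤ c)
    (hthin : ∀ A B C : Set X, IsGeodesicTriangle A B C → IsThinTriangle c A B C)
    {A B C : Set X} (hT : IsGeodesicTriangle A B C) {p : X} (hp : p ∈ A)
    (h : ∀ q ∈ B ∪ C, c ≤ dist p q) : c ≤ hyperbolicityConstant X := by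
  have hne : (B ∪ C).Nonempty := by
    obtain ⟨x, y, z, -, hB, -⟩ := hT
    exact ⟨y, Or.inl hB.left_mem⟩
  have h1 : c ≤ thinConstant A B C := by
    refine le_csInf ⟨c, hc, hthin A B C hT⟩ ?_
    rintro d ⟨-, hd, -⟩
    exact ((Metric.le_infDist hne).2 fun {q} hq => h q hq).trans (hd p hp)
  refine h1.trans (le_csSup ⟨c, ?_⟩ ⟨A, B, C, hT, rfl⟩)
  rintro d ⟨A', B', C', hT', rfl⟩
  exact thinConstant_le hc (hthin _ _ _ hT')

end Obstruction

/-! ### Vertices and coordinates in the metric graph -/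

namespace MetricGraph

variable {V : Type*} [Fintype V] {G : SimpleGraph V} {hG : G.Connected}

open Classical in
/-- The vertex `u`, as a point of the metric graph. -/
noncomputable def vtx (hG : G.Connected) (u : V) : MetricGraph G hG where
  coord v := if v = u then 1 else 0
  nonneg v := by split_ifs <;> norm_num
  sum_eq_one := by simp
  on_edge := ⟨u, u, Or.inl rfl, fun w hw _ => by simp [hw]⟩

@[simp] theorem vtx_coord_self (u : V) : (vtx hG u).coord u = 1 := by simp [vtx]

theorem vtx_coord_ne_zero {u v : V} : (vtx hG u).coord v ≠ 0 ↔ v = u := by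
  simp [vtx]

theorem eq_vtx_of_coord_eq_one {x : MetricGraph G hG} {u : V} (h : x.coord u = 1) :
    x = vtx hG u := ext_of_eq_one h (vtx_coord_self u)

/-- A point that is not a vertex is an interior point of an edge. -/
theorem exists_edge_of_ne_vtx {x : MetricGraph G hG} (hx : ∀ u, x ≠ vtx hG u) :
    ∃ a b, G.Adj a b ∧ 0 < x.coord a ∧ 0 < x.coord b ∧ x.coord a + x.coord b = 1 ∧
      ∀ w, w ≠ a → w ≠ b → x.coord w = 0 := by
  obtain ⟨a, b, hab, h⟩ := x.on_edge
  rcases hab with rfl | hab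
  · refine absurd (eq_vtx_of_coord_eq_one (u := a) ?_) (hx a)
    rw [← x.sum_eq_one]
    exact (Fintype.sum_eq_single a fun w hw => h w hw hw).symm
  · have hs := x.sum_pair hab.ne h
    refine ⟨a, b, hab, (x.nonneg a).lt_of_ne fun h0 => hx b ?_,
      (x.nonneg b).lt_of_ne fun h0 => hx a ?_, hs, h⟩
    · exact eq_vtx_of_coord_eq_one (by linarith)
    · exact eq_vtx_of_coord_eq_one (by linarith)

/-- Two positive coordinates determine the edge of a point. -/
theorem edge_of_pos {x : MetricGraph G hG} {a b : V} (hab : a ≠ b) (ha : x.coord a ≠ 0)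
    (hb : x.coord b ≠ 0) : G.Adj a b ∧ x.coord a + x.coord b = 1 ∧
      ∀ w, w ≠ a → w ≠ b → x.coord w = 0 := by
  have hv : ∀ u, x ≠ vtx hG u := by
    rintro u rfl
    exact hab ((vtx_coord_ne_zero.1 ha).trans (vtx_coord_ne_zero.1 hb).symm)
  obtain ⟨c, d, hcd, -, -, hs, h⟩ := exists_edge_of_ne_vtx hv
  have ha' : a = c ∨ a = d := by by_contra! hn; exact ha (h a hn.1 hn.2)
  have hb' : b = c ∨ b = d := by by_contra! hn; exact hb (h b hn.1 hn.2)
  rcases ha' with rfl | rfl <;> rcases hb' with rfl | rfl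
  · exact absurd rfl hab
  · exact ⟨hcd, hs, h⟩
  · exact ⟨hcd.symm, by linarith, fun w h1 h2 => h w h2 h1⟩
  · exact absurd rfl hab

theorem coord_add_le_one (x : MetricGraph G hG) {a b : V} (hab : a ≠ b) :
    x.coord a + x.coord b ≤ 1 := by
  by_cases ha : x.coord a = 0
  · rw [ha, zero_add]; exact x.coord_le_one b
  by_cases hb : x.coord b = 0
  · rw [hb, add_zero]; exact x.coord_le_one a
  exact (edge_of_pos hab ha hb).2.1.le

/-- A shortest path between two points runs through vertices, unless both points are interior
points of one edge. -/
theorem dist_cases (x y : MetricGraph G hG) :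
    (∃ u v, x.coord u ≠ 0 ∧ y.coord v ≠ 0 ∧
      dist x y = (1 - x.coord u) + (G.dist u v : ℝ) + (1 - y.coord v)) ∨
    ∃ a b, G.Adj a b ∧ x.coord a ≠ 0 ∧ x.coord b ≠ 0 ∧ y.coord a ≠ 0 ∧ y.coord b ≠ 0 ∧
      dist x y = |x.coord a - y.coord a| := by
  have vert : ∀ (x y : MetricGraph G hG) {a b : V}, G.Adj a b →
      (∀ w, w ≠ a → w ≠ b → x.coord w = 0 ∧ y.coord w = 0) → x.coord b = 0 →
      dist x y = |x.coord a - y.coord a| →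
      ∃ u v, x.coord u ≠ 0 ∧ y.coord v ≠ 0 ∧
        dist x y = (1 - x.coord u) + (G.dist u v : ℝ) + (1 - y.coord v) := by
    intro x y a b hab h hb hd
    have hx := x.sum_pair hab.ne fun w p q => (h w p q).1
    have hy := y.sum_pair hab.ne fun w p q => (h w p q).2
    have hxa : x.coord a = 1 := by linarith
    have hle := y.coord_le_one a
    rw [hxa, abs_of_nonneg (by linarith)] at hd
    by_cases hya : y.coord a = 0
    · have hyb : y.coord b = 1 := by linarith
      refine ⟨a, b, by rw [hxa]; norm_num, by rw [hyb]; norm_num, ?_⟩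
      rw [SimpleGraph.dist_eq_one_iff_adj.2 hab, hd, hxa, hyb, hya]; norm_num
    · refine ⟨a, a, by rw [hxa]; norm_num, hya, ?_⟩
      rw [SimpleGraph.dist_self, hd, hxa]; push_cast; ring
  rcases dist_mem x y with h | ⟨⟨a, b, hab, h⟩, hd⟩
  · exact Or.inl h
  rw [half_sum x y hab.ne h] at hd
  have hx := x.sum_pair hab.ne fun w p q => (h w p q).1
  have hy := y.sum_pair hab.ne fun w p q => (h w p q).2
  have hd' : dist x y = |x.coord b - y.coord b| := by
    rw [hd, ← abs_neg]; congr 1; linarith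
  by_cases hxa : x.coord a = 0
  · exact Or.inl (vert x y hab.symm (fun w p q => h w q p) hxa hd')
  by_cases hxb : x.coord b = 0
  · exact Or.inl (vert x y hab h hxb hd)
  have flip : (∃ u v, y.coord u ≠ 0 ∧ x.coord v ≠ 0 ∧
        dist y x = (1 - y.coord u) + (G.dist u v : ℝ) + (1 - x.coord v)) →
      ∃ u v, x.coord u ≠ 0 ∧ y.coord v ≠ 0 ∧
        dist x y = (1 - x.coord u) + (G.dist u v : ℝ) + (1 - y.coord v) := by
    rintro ⟨u, v, hu, hv, e⟩
    exact ⟨v, u, hv, hu, by rw [dist_comm, e, G.dist_comm]; ring⟩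
  by_cases hya : y.coord a = 0
  · refine Or.inl (flip (vert y x hab.symm (fun w p q => (h w q p).symm) hya ?_))
    rw [dist_comm, hd', abs_sub_comm]
  by_cases hyb : y.coord b = 0
  · refine Or.inl (flip (vert y x hab (fun w p q => (h w p q).symm) hyb ?_))
    rw [dist_comm, hd, abs_sub_comm]
  exact Or.inr ⟨a, b, hab, hxa, hxb, hya, hyb, hd⟩

/-- A shortest path to a vertex runs through a vertex of the edge of the other point. -/
theorem exists_dist_vtx (x : MetricGraph G hG) (v : V) :
    ∃ u, x.coord u ≠ 0 ∧ dist x (vtx hG v) = (1 - x.coord u) + (G.dist u v : ℝ) := by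
  rcases dist_cases x (vtx hG v) with ⟨u, w, hu, hw, e⟩ | ⟨a, b, hab, -, -, ha, hb, -⟩
  · rw [vtx_coord_ne_zero] at hw
    subst hw
    exact ⟨u, hu, by rw [e, vtx_coord_self]; ring⟩
  · rw [vtx_coord_ne_zero] at ha hb
    exact absurd (ha.trans hb.symm) hab.ne

theorem dist_vtx_le (x : MetricGraph G hG) {u : V} (hu : x.coord u ≠ 0) (v : V) :
    dist x (vtx hG v) ≤ (1 - x.coord u) + (G.dist u v : ℝ) :=
  dist_le (Or.inl ⟨u, v, hu, by simp, by simp⟩)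

@[simp] theorem dist_vtx_vtx (u v : V) : dist (vtx hG u) (vtx hG v) = G.dist u v := by
  obtain ⟨w, hw, e⟩ := exists_dist_vtx (vtx hG u) v
  rw [vtx_coord_ne_zero] at hw
  subst hw
  simpa using e

/-- A point at integer distance from a vertex is a vertex. -/
theorem eq_vtx_of_dist_eq_natCast {x : MetricGraph G hG} {v : V} {k : ℕ}
    (h : dist x (vtx hG v) = k) : ∃ u, x = vtx hG u ∧ G.dist u v = k := by
  obtain ⟨u, hu, e⟩ := exists_dist_vtx x v
  have h0 : 0 < x.coord u := (x.nonneg u).lt_of_ne' hu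
  have h1 := x.coord_le_one u
  rw [h] at e
  have h2 : k = G.dist u v := by
    have a1 : (G.dist u v : ℝ) ≤ k := by linarith
    have a2 : (k : ℝ) < G.dist u v + 1 := by linarith
    exact le_antisymm (Nat.lt_succ_iff.1 (by exact_mod_cast a2)) (by exact_mod_cast a1)
  refine ⟨u, eq_vtx_of_coord_eq_one ?_, h2.symm⟩
  rw [← h2] at e
  linarith

theorem abs_coord_sub_le_dist (x y : MetricGraph G hG) (a : V) :
    |x.coord a - y.coord a| ≤ dist x y := by
  have hxa := x.coord_le_one a
  have hya := y.coord_le_one a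
  have hx0 := x.nonneg a
  have hy0 := y.nonneg a
  rcases dist_mem x y with ⟨u, v, hu, hv, e⟩ | ⟨⟨c, d, hcd, h⟩, e⟩
  · rw [e]
    have hxu := x.coord_le_one u
    have hyv := y.coord_le_one v
    by_cases huv : u = v
    · subst huv
      rw [SimpleGraph.dist_self, Nat.cast_zero]
      by_cases hau : a = u
      · subst hau
        exact abs_le.2 ⟨by linarith, by linarith⟩
      · have h1 := x.coord_add_le_one hau
        have h2 := y.coord_add_le_one hau
        exact abs_le.2 ⟨by linarith, by linarith⟩
    · have h1 : (1 : ℝ) ≤ G.dist u v := by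
        exact_mod_cast hG.pos_dist_of_ne huv
      exact abs_le.2 ⟨by linarith, by linarith⟩
  · rw [e]
    by_cases hac : a = c
    · rw [half_sum x y hcd.ne h, hac]
    by_cases had : a = d
    · rw [half_sum x y hcd.ne.symm (fun w p q => h w q p), had]
    · rw [(h a hac had).1, (h a hac had).2, sub_self, abs_zero]; positivity

theorem continuous_coord (a : V) : Continuous fun x : MetricGraph G hG => x.coord a := by
  refine LipschitzWith.continuous (K := 1) (LipschitzWith.of_dist_le_mul fun x y => ?_)
  simpa [Real.dist_eq] using abs_coord_sub_le_dist x y a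

theorem dist_lt_one_of_pos {x y : MetricGraph G hG} {a b : V} (hab : a ≠ b)
    (hxa : x.coord a ≠ 0) (hxb : x.coord b ≠ 0) (hya : y.coord a ≠ 0) (hyb : y.coord b ≠ 0) :
    dist x y < 1 := by
  obtain ⟨h, hx, hx'⟩ := edge_of_pos hab hxa hxb
  obtain ⟨-, hy, hy'⟩ := edge_of_pos hab hya hyb
  have hc : ∀ w, w ≠ a → w ≠ b → x.coord w = 0 ∧ y.coord w = 0 :=
    fun w p q => ⟨hx' w p q, hy' w p q⟩
  refine (dist_le (Or.inr ⟨⟨a, b, h, hc⟩, rfl⟩)).trans_lt ?_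
  rw [half_sum x y hab hc]
  have h1 := (x.nonneg a).lt_of_ne' hxa
  have h2 := (x.nonneg b).lt_of_ne' hxb
  have h3 := (y.nonneg a).lt_of_ne' hya
  have h4 := (y.nonneg b).lt_of_ne' hyb
  exact abs_lt.2 ⟨by linarith, by linarith⟩

/-- A connected set leaves an open edge only through one of its ends. -/
theorem pos_of_isPreconnected {Q : Set (MetricGraph G hG)} (hQ : IsPreconnected Q) {a b : V}
    (hab : a ≠ b) (ha : vtx hG a ∉ Q) (hb : vtx hG b ∉ Q) {x y : MetricGraph G hG} (hx : x ∈ Q)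
    (hxa : x.coord a ≠ 0) (hxb : x.coord b ≠ 0) (hy : y ∈ Q) :
    y.coord a ≠ 0 ∧ y.coord b ≠ 0 := by
  let U : Set (MetricGraph G hG) := {q | q.coord a ≠ 0 ∧ q.coord b ≠ 0}
  let W : Set (MetricGraph G hG) := {q | q.coord a + q.coord b < 1}
  have hU : IsOpen U := (isOpen_ne_fun (continuous_coord a) continuous_const).inter
    (isOpen_ne_fun (continuous_coord b) continuous_const)
  have hW : IsOpen W :=
    isOpen_lt ((continuous_coord a).add (continuous_coord b)) continuous_const
  have hdisj : Disjoint U W := by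
    rw [Set.disjoint_left]
    rintro q ⟨h1, h2⟩ h3
    exact absurd (edge_of_pos hab h1 h2).2.1 (ne_of_lt h3)
  have hsub : Q ⊆ U ∪ W := by
    intro q hq
    by_contra hn
    rw [Set.mem_union, not_or] at hn
    have h1 : 1 ≤ q.coord a + q.coord b := not_lt.1 hn.2
    refine hn.1 ⟨fun h0 => hb ?_, fun h0 => ha ?_⟩
    · rw [← eq_vtx_of_coord_eq_one (le_antisymm (q.coord_le_one b) (by linarith))]; exact hq
    · rw [← eq_vtx_of_coord_eq_one (le_antisymm (q.coord_le_one a) (by linarith))]; exact hq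
  exact hQ.subset_left_of_subset_union hU hW hdisj hsub ⟨x, hx, hxa, hxb⟩ hy

/-- A connected set with two points at distance at least `1` contains a vertex. -/
theorem exists_vtx_mem {Q : Set (MetricGraph G hG)} (hQ : IsPreconnected Q)
    {x y : MetricGraph G hG} (hx : x ∈ Q) (hy : y ∈ Q) (h : 1 ≤ dist x y) :
    ∃ u, vtx hG u ∈ Q := by
  by_contra! hn
  obtain ⟨a, b, hab, ha, hb, -⟩ := exists_edge_of_ne_vtx (x := x) (fun u hu => hn u (hu ▸ hx))
  obtain ⟨h1, h2⟩ := pos_of_isPreconnected hQ hab.ne (hn a) (hn b) hx ha.ne' hb.ne' hy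
  exact absurd (dist_lt_one_of_pos hab.ne ha.ne' hb.ne' h1 h2) (not_lt.2 h)

/-- If a connected set leaves the edge of its point `x` without using the end `w`, then it contains
the other end. -/
theorem exists_other_end_mem {Q : Set (MetricGraph G hG)} (hQ : IsPreconnected Q)
    {x y : MetricGraph G hG} (hx : x ∈ Q) (hy : y ∈ Q) (h : 1 ≤ dist x y) {w : V}
    (hw : vtx hG w ∉ Q) (hxw : dist x (vtx hG w) ≤ 1) :
    ∃ c, vtx hG c ∈ Q ∧ dist x (vtx hG c) ≤ 1 - dist x (vtx hG w) := by
  by_cases hv : ∀ u, x ≠ vtx hG u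
  · obtain ⟨a, b, hab, ha, hb, hs, h0⟩ := exists_edge_of_ne_vtx hv
    have hw' : x.coord w ≠ 0 := by
      intro hw0
      obtain ⟨u, hu, e⟩ := exists_dist_vtx x w
      have h1 : (1 : ℝ) ≤ G.dist u w := by
        exact_mod_cast hG.pos_dist_of_ne fun h : u = w => hu (h ▸ hw0)
      have h2 : x.coord u ≠ 1 := fun h => hv u (eq_vtx_of_coord_eq_one h)
      have h3 := lt_of_le_of_ne (x.coord_le_one u) h2
      linarith
    obtain ⟨b, hwb, hb⟩ : ∃ b, b ≠ w ∧ x.coord b ≠ 0 := by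
      by_cases haw : a = w
      · exact ⟨b, fun h => hab.ne (haw.trans h.symm), hb.ne'⟩
      · exact ⟨a, haw, ha.ne'⟩
    obtain ⟨-, hs, -⟩ := edge_of_pos hwb.symm hw' hb
    have h1 := dist_vtx_le x hw' w
    have h2 := dist_vtx_le x hb b
    rw [SimpleGraph.dist_self, Nat.cast_zero] at h1 h2
    refine ⟨b, ?_, by linarith⟩
    by_contra hbQ
    obtain ⟨h3, h4⟩ := pos_of_isPreconnected hQ hwb.symm hw hbQ hx hw' hb hy
    exact absurd (dist_lt_one_of_pos hwb.symm hw' hb h3 h4) (not_lt.2 h)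
  · push Not at hv
    obtain ⟨u, rfl⟩ := hv
    exact ⟨u, hx, by simpa using hxw⟩

/-- A connected set through a vertex `c` meets the spheres around any vertex in vertices. -/
theorem exists_vtx_mem_of_dist {Q : Set (MetricGraph G hG)} (hQ : IsPreconnected Q)
    {x y : MetricGraph G hG} (hx : x ∈ Q) (hy : y ∈ Q) (c : V) {k : ℕ}
    (h1 : dist x (vtx hG c) ≤ k) (h2 : k ≤ dist y (vtx hG c)) :
    ∃ u, vtx hG u ∈ Q ∧ G.dist u c = k := by
  obtain ⟨q, hq, e⟩ := hQ.intermediate_value hx hy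
    (f := fun q => dist q (vtx hG c)) (by fun_prop) ⟨h1, h2⟩
  obtain ⟨u, rfl, hu⟩ := eq_vtx_of_dist_eq_natCast e
  exact ⟨u, hq, hu⟩

end MetricGraph

/-! ### Detours in the metric graph -/

namespace MetricGraph

variable {V : Type*} [Fintype V] {G : SimpleGraph V} {hG : G.Connected} {D : ℝ}
  {γ : ℝ → MetricGraph G hG} {Q : Set (MetricGraph G hG)}

theorem _root_.IsDetour.exists_vtx_add (h : IsDetour D γ Q) {σ : ℝ} {u : V} (hσ : -D ≤ σ)
    (hu : γ σ = vtx hG u) (j : ℕ) (hj : σ + j ≤ D) :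
    ∃ v, γ (σ + j) = vtx hG v ∧ G.dist v u = j := by
  have hj0 : (0 : ℝ) ≤ j := Nat.cast_nonneg j
  apply eq_vtx_of_dist_eq_natCast
  rw [← hu, h.isometric _ ⟨by linarith, hj⟩ _ ⟨hσ, by linarith⟩, add_sub_cancel_left,
    abs_of_nonneg hj0]

theorem _root_.IsDetour.exists_first_vtx (h : IsDetour D γ Q) (hD : 1 / 2 ≤ D) :
    ∃ σ u, -D < σ ∧ σ ≤ -D + 1 ∧ γ σ = vtx hG u := by
  have hsub : Set.Icc (-D) (-D + 1) ⊆ Set.Icc (-D) D := Set.Icc_subset_Icc_right (by linarith)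
  obtain ⟨u, σ, hσ, hu⟩ := exists_vtx_mem
    (isPreconnected_Icc.image γ (h.continuousOn.mono hsub))
    (Set.mem_image_of_mem γ (Set.left_mem_Icc.2 (by linarith : -D ≤ -D + 1)))
    (Set.mem_image_of_mem γ (Set.right_mem_Icc.2 (by linarith : -D ≤ -D + 1)))
    (by rw [h.isometric _ (hsub ⟨le_rfl, by linarith⟩) _ (hsub ⟨by linarith, le_rfl⟩)]
        simp)
  rcases hσ.1.eq_or_lt with rfl | h1
  · obtain ⟨v, hv, -⟩ := h.exists_vtx_add le_rfl hu 1 (by push_cast; linarith)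
    exact ⟨-D + 1, v, by linarith, le_rfl, by simpa using hv⟩
  · exact ⟨σ, u, h1, hσ.2, hu⟩

/-- The vertices on the geodesic of a detour and those on its connected set together are at least
as many as the length `4 * D` of a closed walk around the detour. -/
theorem _root_.IsDetour.le_card (h : IsDetour D γ Q) (hD : 1 / 2 < D) :
    4 * D ≤ Fintype.card V := by
  classical
  obtain ⟨σ, w, hσ1, hσ2, hw⟩ := h.exists_first_vtx hD.le
  -- `σ + K` is the position of the last vertex inside the geodesic
  obtain ⟨K, hK1, hK2⟩ : ∃ K : ℕ, σ + K < D ∧ D ≤ σ + K + 1 := by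
    obtain ⟨K, hK⟩ : ∃ K : ℕ, ⌈D - σ⌉₊ = K + 1 :=
      Nat.exists_eq_succ_of_ne_zero (Nat.ceil_pos.2 (by linarith)).ne'
    have h1 := Nat.le_ceil (D - σ)
    have h2 := Nat.ceil_lt_add_one (a := D - σ) (by linarith)
    rw [hK] at h1 h2
    push_cast at h1 h2
    exact ⟨K, by linarith, by linarith⟩
  have hK0 : (0 : ℝ) ≤ K := Nat.cast_nonneg K
  obtain ⟨w', hw', -⟩ := h.exists_vtx_add hσ1.le hw K hK1.le
  have hl : (-D) ∈ Set.Icc (-D) D := ⟨le_rfl, by linarith⟩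
  have hr : D ∈ Set.Icc (-D) D := ⟨by linarith, le_rfl⟩
  have hlr : 1 ≤ dist (γ (-D)) (γ D) := by
    rw [h.isometric _ hl _ hr, abs_sub_comm, abs_of_nonneg] <;> linarith
  have hlw : dist (γ (-D)) (vtx hG w) = σ + D := by
    rw [← hw, h.isometric _ hl _ ⟨hσ1.le, by linarith⟩, abs_sub_comm, abs_of_nonneg] <;> linarith
  have hrw : dist (γ D) (vtx hG w') = D - (σ + K) := by
    rw [← hw', h.isometric _ hr _ ⟨by linarith, hK1.le⟩, abs_of_nonneg]; linarith
  obtain ⟨c, hc, hlc⟩ := exists_other_end_mem h.isPreconnected h.left_mem h.right_mem hlr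
    (w := w) (hw ▸ h.notMem hσ1 (by linarith)) (by linarith)
  obtain ⟨e, he, hre⟩ := exists_other_end_mem h.isPreconnected h.right_mem h.left_mem
    (by rwa [dist_comm]) (w := w') (hw' ▸ h.notMem (by linarith) hK1) (by linarith)
  have hce : 2 * D - 2 + (σ + D) + (D - (σ + K)) ≤ G.dist e c := by
    have h1 := dist_triangle4 (γ (-D)) (vtx hG c) (vtx hG e) (γ D)
    rw [h.isometric _ hl _ hr, abs_sub_comm, abs_of_nonneg (by linarith), dist_vtx_vtx,
      dist_comm (vtx hG e), G.dist_comm] at h1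
    linarith
  have hin : K + 1 ≤ (Finset.univ.filter fun v => vtx hG v ∉ Q).card := by
    rw [← Finset.card_range (K + 1)]
    refine Finset.card_le_card_of_surjOn (fun v => G.dist v w) fun j hj => ?_
    have hj : (j : ℝ) ≤ K := by
      exact_mod_cast Nat.lt_succ_iff.1 (by simpa using hj)
    have hj0 : (0 : ℝ) ≤ j := Nat.cast_nonneg j
    obtain ⟨v, hv, hvj⟩ := h.exists_vtx_add hσ1.le hw j (by linarith)
    exact ⟨v, by simpa using hv ▸ h.notMem (by linarith) (by linarith), hvj⟩
  have hout : G.dist e c + 1 ≤ (Finset.univ.filter fun v => vtx hG v ∈ Q).card := by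
    rw [← Finset.card_range (G.dist e c + 1)]
    refine Finset.card_le_card_of_surjOn (fun v => G.dist v c) fun j hj => ?_
    have hj : j ≤ G.dist e c := Nat.lt_succ_iff.1 (by simpa using hj)
    obtain ⟨u, hu, huj⟩ := exists_vtx_mem_of_dist h.isPreconnected hc he c (k := j)
      (by simp) (by simpa using hj)
    exact ⟨u, by simpa using hu, huj⟩
  have hsum := Finset.card_filter_add_card_filter_not (s := (Finset.univ : Finset V))
    (fun v => vtx hG v ∈ Q)
  rw [Finset.card_univ] at hsum
  have : ((K + 1 + (G.dist e c + 1) : ℕ) : ℝ) ≤ Fintype.card V := by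
    rw [← hsum]; exact_mod_cast (add_comm _ _).trans_le (add_le_add hout hin)
  push_cast at this
  linarith

theorem isThinTriangle_card_div_four (hV : 2 ≤ Fintype.card V) {A B C : Set (MetricGraph G hG)}
    (hT : IsGeodesicTriangle A B C) : IsThinTriangle ((Fintype.card V : ℝ) / 4) A B C := by
  have hV' : (2 : ℝ) ≤ Fintype.card V := by exact_mod_cast hV
  refine isThinTriangle_of_no_detour (by positivity) one_pos (fun D γ Q h1 _ h => ?_) hT
  linarith [h.le_card (by linarith)]

theorem hyperbolicityConstant_le_card_div_four (hV : 2 ≤ Fintype.card V) :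
    hyperbolicityConstant (MetricGraph G hG) ≤ (Fintype.card V : ℝ) / 4 := by
  have hV' : (2 : ℝ) ≤ Fintype.card V := by exact_mod_cast hV
  refine hyperbolicityConstant_le_of_no_detour (by positivity) one_pos fun D γ Q h1 _ h => ?_
  linarith [h.le_card (by linarith)]

/-- The distance layers around a vertex `w`, near one end of the geodesic of a detour: each layer
before the `r`-th contains a vertex of the geodesic and a vertex of the connected set. -/
theorem _root_.IsDetour.exists_layers_of_first_vtx (h : IsDetour D γ Q) {r : ℕ} (hr : 1 ≤ r)
    {σ : ℝ} {w : V} (hσ1 : -D < σ) (hσ2 : σ ≤ -D + 1) (hw : γ σ = vtx hG w)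
    (hfar : (r : ℝ) - 1 / 2 < D - σ) :
    (∀ j, 1 ≤ j → j < r → ∃ u v, u ≠ v ∧ G.dist u w = j ∧ G.dist v w = j) ∧
      ∃ u, r ≤ G.dist u w := by
  have hr' : (1 : ℝ) ≤ r := by exact_mod_cast hr
  have hσI : σ ∈ Set.Icc (-D) D := ⟨hσ1.le, by linarith⟩
  have hl : dist (γ (-D)) (vtx hG w) = σ + D := by
    rw [← hw, h.isometric _ ⟨le_rfl, by linarith⟩ _ hσI, abs_sub_comm, abs_of_nonneg] <;> linarith
  have hr : dist (γ D) (vtx hG w) = D - σ := by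
    rw [← hw, h.isometric _ ⟨by linarith, le_rfl⟩ _ hσI, abs_of_nonneg]; linarith
  constructor
  · intro j hj1 hj2
    have hj1' : (1 : ℝ) ≤ j := by exact_mod_cast hj1
    have hj2' : (j : ℝ) + 1 ≤ r := by exact_mod_cast hj2
    obtain ⟨u, hu, huj⟩ := h.exists_vtx_add hσ1.le hw j (by linarith)
    obtain ⟨v, hv, hvj⟩ := exists_vtx_mem_of_dist h.isPreconnected h.left_mem h.right_mem w (k := j)
      (by linarith) (by linarith)
    refine ⟨u, v, ?_, huj, hvj⟩
    rintro rfl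
    exact h.notMem (by linarith) (by linarith) (hu ▸ hv)
  · by_contra! hn
    have hn' : ∀ u, (G.dist u w : ℝ) + 1 ≤ r := fun u => by exact_mod_cast hn u
    -- a point has a coordinate at least `1 / 2`, hence lies within `1 / 2` of a vertex
    obtain ⟨u, hu⟩ : ∃ u, 1 / 2 ≤ (γ D).coord u := by
      by_cases hv : ∀ u, γ D ≠ vtx hG u
      · obtain ⟨a, b, -, -, -, hs, -⟩ := exists_edge_of_ne_vtx hv
        by_contra! hc
        linarith [hc a, hc b]
      · push Not at hv
        obtain ⟨u, hu⟩ := hv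
        exact ⟨u, by rw [hu, vtx_coord_self]; norm_num⟩
    have := dist_vtx_le (γ D) (u := u) (by linarith) w
    linarith [hn' u]

theorem _root_.IsDetour.exists_layers (h : IsDetour D γ Q) {r : ℕ} (hr : 2 ≤ r)
    (h1 : (r : ℝ) / 2 < D) (h2 : D ≤ (r : ℝ) / 2 + 1 / 4) :
    ∃ w, (∀ j, 1 ≤ j → j < r → ∃ u v, u ≠ v ∧ G.dist u w = j ∧ G.dist v w = j) ∧
      ∃ u, r ≤ G.dist u w := by
  have hr' : (2 : ℝ) ≤ r := by exact_mod_cast hr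
  obtain ⟨σ, w, hσ1, hσ2, hw⟩ := h.exists_first_vtx (by linarith)
  by_cases hg : σ + D ≤ 1 / 2
  · exact ⟨w, h.exists_layers_of_first_vtx (by omega) hσ1 hσ2 hw (by linarith)⟩
  -- otherwise the other direction works, starting with the `r`-th vertex of the geodesic
  · have hr1 : ((r - 1 : ℕ) : ℝ) = r - 1 := by rw [Nat.cast_sub (by omega)]; norm_num
    obtain ⟨w', hw', -⟩ := h.exists_vtx_add hσ1.le hw (r - 1) (by rw [hr1]; linarith)
    refine ⟨w', h.reverse.exists_layers_of_first_vtx (σ := -(σ + (r - 1 : ℕ))) (by omega)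
      ?_ ?_ (by simpa using hw') ?_⟩ <;> rw [hr1] <;> linarith

/-- A detour forces a cycle: the edge of a point `p` of its geodesic is not a bridge. Otherwise the
total weight of a point on one side of the bridge is a continuous function that separates `p` from
all other points, while the detour joins the two sides around `p`. -/
theorem _root_.IsDetour.not_isAcyclic (h : IsDetour D γ Q) (hD : 0 < D) : ¬ G.IsAcyclic := by
  classical
  intro hT
  obtain ⟨s, hs1, hs2, hv⟩ : ∃ s, 0 ≤ s ∧ s < D ∧ ∀ u, γ s ≠ vtx hG u := by
    by_contra! hn
    obtain ⟨u, hu⟩ := hn 0 le_rfl hD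
    have h1 : 0 < min D 1 / 2 := by positivity
    have h2 : min D 1 / 2 < D := by linarith [min_le_left D 1]
    obtain ⟨v, hv⟩ := hn (min D 1 / 2) h1.le h2
    have h3 := h.isometric (min D 1 / 2) ⟨by linarith, h2.le⟩ 0 ⟨by linarith, hD.le⟩
    rw [hu, hv, dist_vtx_vtx, sub_zero, abs_of_pos h1] at h3
    have h4 : (G.dist v u : ℝ) < 1 := by linarith [min_le_right D 1]
    have h5 : G.dist v u = 0 := by
      have : G.dist v u < 1 := by exact_mod_cast h4
      omega
    rw [h5] at h3
    push_cast at h3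
    linarith
  obtain ⟨a, b, hab, ha, hb, hsum, h0⟩ := exists_edge_of_ne_vtx hv
  set p := γ s with hp
  have hbridge := SimpleGraph.isAcyclic_iff_forall_adj_isBridge.1 hT hab
  rw [SimpleGraph.isBridge_iff] at hbridge
  set G' := G.deleteEdges {s(a, b)} with hG'
  -- the total weight on the side of `a`
  let F : MetricGraph G hG → ℝ := fun q => ∑ v ∈ Finset.univ.filter (G'.Reachable a), q.coord v
  have hF : Continuous F := continuous_finsetSum _ fun v _ => continuous_coord v
  -- two adjacent vertices on different sides are `a` and `b`
  have hcross : ∀ c d, G.Adj c d → G'.Reachable a c → ¬ G'.Reachable a d → c = a ∧ d = b := by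
    intro c d hcd hc hd
    have : ¬ G'.Adj c d := fun hadj => hd (hc.trans hadj.reachable)
    rw [hG', SimpleGraph.deleteEdges_adj] at this
    simp only [hcd, true_and, not_not, Set.mem_singleton_iff, Sym2.eq_iff] at this
    rcases this with h | ⟨rfl, rfl⟩
    · exact h
    · exact absurd (SimpleGraph.Reachable.refl _) hd
  have hF_edge : ∀ q : MetricGraph G hG, q.coord a ≠ 0 → q.coord b ≠ 0 → F q = q.coord a := by
    intro q hqa hqb
    obtain ⟨-, -, hq⟩ := edge_of_pos hab.ne hqa hqb
    refine Finset.sum_eq_single a (fun w hw hwa => ?_) (fun hn => ?_)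
    · refine hq w hwa ?_
      rintro rfl
      exact hbridge (Finset.mem_filter.1 hw).2
    · exact absurd (Finset.mem_filter.2 ⟨Finset.mem_univ _, SimpleGraph.Reachable.refl _⟩) hn
  have hF_val : ∀ q : MetricGraph G hG, 0 < F q → F q < 1 → q.coord a ≠ 0 ∧ q.coord b ≠ 0 := by
    intro q h1 h2
    obtain ⟨c, hc, hqc⟩ := Finset.exists_ne_zero_of_sum_ne_zero h1.ne'
    have hd : ∃ d, ¬ G'.Reachable a d ∧ q.coord d ≠ 0 := by
      by_contra! hn
      have : F q = 1 := by
        rw [← q.sum_eq_one]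
        refine Finset.sum_subset (Finset.subset_univ _) fun w _ hw => hn w fun hw' => hw ?_
        exact Finset.mem_filter.2 ⟨Finset.mem_univ _, hw'⟩
      linarith
    obtain ⟨d, hd, hqd⟩ := hd
    have hc' := (Finset.mem_filter.1 hc).2
    have hcd : c ≠ d := by rintro rfl; exact hd hc'
    obtain ⟨rfl, rfl⟩ := hcross c d (edge_of_pos hcd hqc hqd).1 hc' hd
    exact ⟨hqc, hqd⟩
  have hF_inj : ∀ q : MetricGraph G hG, F q = F p → q = p := by
    intro q hq
    have hFp := hF_edge p ha.ne' hb.ne'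
    obtain ⟨h1, h2⟩ := hF_val q (by rw [hq, hFp]; exact ha) (by rw [hq, hFp]; linarith)
    rw [hF_edge q h1 h2, hFp] at hq
    obtain ⟨-, h3, h4⟩ := edge_of_pos hab.ne h1 h2
    ext w
    by_cases hwa : w = a
    · rw [hwa, hq]
    by_cases hwb : w = b
    · rw [hwb]; linarith
    rw [h0 w hwa hwb, h4 w hwa hwb]
  obtain ⟨η, hη0, hη1, hη2, hη3⟩ : ∃ η, 0 < η ∧ η < p.coord a ∧ η < p.coord b ∧ s + η ≤ D := by
    refine ⟨min (min (p.coord a) (p.coord b)) (D - s) / 2, ?_, ?_, ?_, ?_⟩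
    · have : 0 < D - s := by linarith
      positivity
    all_goals
      have h1 := min_le_left (min (p.coord a) (p.coord b)) (D - s)
      have h2 := min_le_right (min (p.coord a) (p.coord b)) (D - s)
      have h3 := min_le_left (p.coord a) (p.coord b)
      have h4 := min_le_right (p.coord a) (p.coord b)
      linarith
  have hnear : ∀ t ∈ Set.Icc (-D) D, |s - t| = η → |F (γ t) - F p| = η := by
    intro t ht hst
    have hd := h.isometric s ⟨by linarith, hs2.le⟩ t ht
    rw [hst] at hd
    rcases dist_cases p (γ t) with ⟨u, v, hu, hv, e⟩ | ⟨c, d, hcd, h1, h2, h3, h4, e⟩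
    · have h1 : 0 ≤ 1 - (γ t).coord v := by linarith [(γ t).coord_le_one v]
      have h2 : (0 : ℝ) ≤ G.dist u v := Nat.cast_nonneg _
      have h3 : u = a ∨ u = b := by by_contra! hn; exact hu (h0 u hn.1 hn.2)
      rw [← hp, e] at hd
      rcases h3 with rfl | rfl <;> linarith
    · have hc : c = a ∨ c = b := by by_contra! hn; exact h1 (h0 c hn.1 hn.2)
      have hd' : d = a ∨ d = b := by by_contra! hn; exact h2 (h0 d hn.1 hn.2)
      have hne := hcd.ne
      have hq : (γ t).coord a ≠ 0 ∧ (γ t).coord b ≠ 0 := by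
        rcases hc with hc | hc <;> rcases hd' with hd' | hd'
        exacts [absurd (hc.trans hd'.symm) hne, ⟨hc ▸ h3, hd' ▸ h4⟩, ⟨hd' ▸ h4, hc ▸ h3⟩,
          absurd (hc.trans hd'.symm) hne]
      rw [hF_edge _ hq.1 hq.2, hF_edge _ ha.ne' hb.ne', ← hd, ← hp, e]
      obtain ⟨-, hsum', -⟩ := edge_of_pos hab.ne hq.1 hq.2
      rcases hc with rfl | rfl
      · exact abs_sub_comm _ _
      · congr 1; linarith
  have hm1 : s - η ∈ Set.Icc (-D) D := ⟨by linarith, by linarith⟩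
  have hm2 : s + η ∈ Set.Icc (-D) D := ⟨by linarith, hη3⟩
  have hn1 := hnear _ hm1 (by rw [sub_sub_cancel, abs_of_pos hη0])
  have hn2 := hnear _ hm2 (by rw [sub_add_cancel_left, abs_neg, abs_of_pos hη0])
  -- the detour around `p`
  have hQ' : IsPreconnected ((γ '' Set.Icc (-D) (s - η) ∪ Q) ∪ γ '' Set.Icc (s + η) D) := by
    have h1 : IsPreconnected (γ '' Set.Icc (-D) (s - η)) :=
      isPreconnected_Icc.image _ (h.continuousOn.mono (Set.Icc_subset_Icc_right hm1.2))
    have h2 : IsPreconnected (γ '' Set.Icc (s + η) D) :=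
      isPreconnected_Icc.image _ (h.continuousOn.mono (Set.Icc_subset_Icc_left hm2.1))
    have h3 : γ (-D) ∈ γ '' Set.Icc (-D) (s - η) := ⟨_, ⟨le_rfl, hm1.1⟩, rfl⟩
    have h4 : γ D ∈ γ '' Set.Icc (s + η) D := ⟨_, ⟨hm2.2, le_rfl⟩, rfl⟩
    exact (h1.union _ h3 h.left_mem h.isPreconnected).union _ (Or.inr h.right_mem) h4 h2
  have hpQ : p ∉ (γ '' Set.Icc (-D) (s - η) ∪ Q) ∪ γ '' Set.Icc (s + η) D := by
    rintro ((⟨t, ht, e⟩ | hq) | ⟨t, ht, e⟩)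
    · have := h.isometric s ⟨by linarith, hs2.le⟩ t ⟨ht.1, by linarith [ht.2]⟩
      rw [e, dist_self, abs_of_pos (by linarith [ht.2])] at this
      linarith [ht.2]
    · exact h.notMem (by linarith) hs2 hq
    · have := h.isometric s ⟨by linarith, hs2.le⟩ t ⟨by linarith [ht.1], ht.2⟩
      rw [e, dist_self, abs_sub_comm, abs_of_pos (by linarith [ht.1])] at this
      linarith [ht.1]
  have hl : γ (s - η) ∈ (γ '' Set.Icc (-D) (s - η) ∪ Q) ∪ γ '' Set.Icc (s + η) D :=
    Or.inl (Or.inl ⟨_, ⟨hm1.1, le_rfl⟩, rfl⟩)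
  have hr : γ (s + η) ∈ (γ '' Set.Icc (-D) (s - η) ∪ Q) ∪ γ '' Set.Icc (s + η) D :=
    Or.inr ⟨_, ⟨le_rfl, hm2.2⟩, rfl⟩
  have hne : F (γ (s - η)) ≠ F (γ (s + η)) := by
    intro he
    have hv : ∀ t ∈ Set.Icc (-D) D, |F (γ t) - F p| = η →
        (γ t).coord a ≠ 0 ∧ (γ t).coord b ≠ 0 := by
      intro t _ ht
      have hFp := hF_edge p ha.ne' hb.ne'
      have := abs_le.1 ht.le
      exact hF_val _ (by linarith) (by linarith)
    obtain ⟨a1, b1⟩ := hv _ hm1 hn1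
    obtain ⟨a2, b2⟩ := hv _ hm2 hn2
    rw [hF_edge _ a1 b1, hF_edge _ a2 b2] at he
    obtain ⟨-, s1, z1⟩ := edge_of_pos hab.ne a1 b1
    obtain ⟨-, s2, z2⟩ := edge_of_pos hab.ne a2 b2
    have heq : γ (s - η) = γ (s + η) := by
      ext w
      by_cases hwa : w = a
      · rw [hwa, he]
      by_cases hwb : w = b
      · rw [hwb]; linarith
      rw [z1 w hwa hwb, z2 w hwa hwb]
    have := h.isometric _ hm1 _ hm2
    rw [heq, dist_self, abs_sub_comm, abs_of_pos (by linarith)] at this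
    linarith
  have hIVT : F p ∈ F '' ((γ '' Set.Icc (-D) (s - η) ∪ Q) ∪ γ '' Set.Icc (s + η) D) := by
    rcases abs_choice (F (γ (s - η)) - F p) with c1 | c1 <;>
      rcases abs_choice (F (γ (s + η)) - F p) with c2 | c2 <;> rw [c1] at hn1 <;> rw [c2] at hn2
    · exact absurd (by linarith) hne
    · exact hQ'.intermediate_value hr hl hF.continuousOn ⟨by linarith, by linarith⟩
    · exact hQ'.intermediate_value hl hr hF.continuousOn ⟨by linarith, by linarith⟩
    · exact absurd (by linarith) hne
  obtain ⟨q, hq, hqF⟩ := hIVT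
  exact hpQ (hF_inj q hqF ▸ hq)

theorem hyperbolicityConstant_eq_zero_of_isAcyclic (hT : G.IsAcyclic) :
    hyperbolicityConstant (MetricGraph G hG) = 0 :=
  le_antisymm (hyperbolicityConstant_le_of_no_detour le_rfl one_pos
    fun _ _ _ hD _ h => h.not_isAcyclic hD hT) (hyperbolicityConstant_nonneg _)

end MetricGraph

/-! ### Closed curves that are far from being thin -/

section ClosedCurve

variable {X : Type*} [MetricSpace X]

theorem isGeodesicSegment_image_of_lipschitz {γ : ℝ → X} {a L : ℝ} (hL : 0 ≤ L)
    (hlip : ∀ s t, a ≤ s → s ≤ t → t ≤ a + L → dist (γ s) (γ t) ≤ t - s)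
    (hd : L ≤ dist (γ a) (γ (a + L))) :
    IsGeodesicSegment (γ '' Set.Icc a (a + L)) (γ a) (γ (a + L)) := by
  have hL' : dist (γ a) (γ (a + L)) = L :=
    le_antisymm ((hlip a (a + L) le_rfl (by linarith) le_rfl).trans (by linarith)) hd
  have hiso : ∀ s t, 0 ≤ s → s ≤ t → t ≤ L → dist (γ (a + s)) (γ (a + t)) = t - s := by
    intro s t h0 hst htL
    have h1 := hlip (a + s) (a + t) (by linarith) (by linarith) (by linarith)
    have h2 := hlip a (a + s) (by linarith) (by linarith) (by linarith)
    have h3 := hlip (a + t) (a + L) (by linarith) (by linarith) (by linarith)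
    have h4 := dist_triangle4 (γ a) (γ (a + s)) (γ (a + t)) (γ (a + L))
    linarith
  refine ⟨fun t => γ (a + t), by simp, by simp only [hL'], ?_, ?_⟩
  · intro s hs t ht
    rw [hL'] at hs ht
    rcases le_total s t with h | h
    · rw [hiso s t hs.1 h ht.2, abs_sub_comm, abs_of_nonneg (by linarith)]
    · rw [dist_comm, hiso t s ht.1 h hs.2, abs_of_nonneg (by linarith)]
  · rw [hL', show (fun t => γ (a + t)) = γ ∘ (fun t => a + t) from rfl, Set.image_comp,
      Set.image_const_add_Icc, add_zero]

theorem isGeodesicSegment_singleton (x : X) : IsGeodesicSegment {x} x x :=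
  ⟨fun _ => x, rfl, rfl, by
    intro s hs t ht
    rw [dist_self, Set.Icc_self, Set.mem_singleton_iff] at hs ht
    simp [hs, ht], by simp⟩

/-- A closed curve of length `2 * L` whose two halves are geodesics, such that the middle of the
first half has distance `L / 2` from the second half: a triangle with one side of length zero. -/
theorem half_le_hyperbolicityConstant {γ : ℝ → X} {a L : ℝ} (hL : 0 ≤ L)
    (hlip : ∀ s t, a ≤ s → s ≤ t → t ≤ a + L + L → dist (γ s) (γ t) ≤ t - s)
    (hclosed : γ (a + L + L) = γ a) (hd : L ≤ dist (γ a) (γ (a + L)))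
    (hmid : ∀ s ∈ Set.Icc (a + L) (a + L + L), L / 2 ≤ dist (γ (a + L / 2)) (γ s))
    (hthin : ∀ A B C : Set X, IsGeodesicTriangle A B C → IsThinTriangle (L / 2) A B C) :
    L / 2 ≤ hyperbolicityConstant X := by
  have hA := isGeodesicSegment_image_of_lipschitz hL
    (fun s t h1 h2 h3 => hlip s t h1 h2 (by linarith)) hd
  have hB := isGeodesicSegment_image_of_lipschitz (a := a + L) hL
    (fun s t h1 h2 h3 => hlip s t (by linarith) h2 h3) (by rwa [hclosed, dist_comm])
  rw [hclosed] at hB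
  refine le_hyperbolicityConstant (by linarith) hthin
    ⟨_, _, _, hA, hB, isGeodesicSegment_singleton _⟩
    (Set.mem_image_of_mem γ (Set.mem_Icc.2 ⟨by linarith, by linarith⟩) : γ (a + L / 2) ∈ _) ?_
  rintro q (⟨s, hs, rfl⟩ | rfl)
  · exact hmid s hs
  · rw [← hclosed]
    exact hmid _ ⟨by linarith, le_rfl⟩

end ClosedCurve

/-! ### Walks as curves in the metric graph -/

namespace MetricGraph

theorem _root_.SimpleGraph.Connected.le_add_dist_of_adj {V : Type*} {G : SimpleGraph V}
    (hG : G.Connected) {φ : V → ℝ} (hφ : ∀ u v, G.Adj u v → φ u ≤ φ v + 1) (u v : V) :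
    φ u ≤ φ v + G.dist u v := by
  obtain ⟨p, hp⟩ := hG.exists_walk_length_eq_dist u v
  rw [← hp]
  clear hp
  induction p with
  | nil => simp
  | cons h p ih =>
    have := hφ _ _ h
    rw [SimpleGraph.Walk.length_cons]
    push_cast
    linarith

variable {V : Type*} [Fintype V] {G : SimpleGraph V} {hG : G.Connected}

open Classical in
/-- The point at distance `t` from `u` on the edge `[u, v]`. -/
noncomputable def edgePoint (hG : G.Connected) {u v : V} (huv : G.Adj u v) (t : ℝ)
    (h0 : 0 ≤ t) (h1 : t ≤ 1) : MetricGraph G hG where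
  coord w := (if w = u then 1 - t else 0) + (if w = v then t else 0)
  nonneg w := by split_ifs <;> linarith
  sum_eq_one := by simp [Finset.sum_add_distrib]
  on_edge := ⟨u, v, Or.inr huv, fun w hu hv => by simp [hu, hv]⟩

/-- The curve of unit speed that is at the vertex `w i` at time `i`. (Negative times, where it takes
junk values, are never used.) -/
noncomputable def walkCurve (hG : G.Connected) {w : ℕ → V} (hw : ∀ i, G.Adj (w i) (w (i + 1)))
    (s : ℝ) : MetricGraph G hG :=
  edgePoint hG (hw ⌊s⌋₊) (Int.fract s) (Int.fract_nonneg s) (Int.fract_lt_one s).le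

variable {w : ℕ → V} (hw : ∀ i, G.Adj (w i) (w (i + 1)))

open Classical in
theorem walkCurve_coord (i : ℕ) {t : ℝ} (h0 : 0 ≤ t) (h1 : t ≤ 1) (v : V) :
    (walkCurve hG hw (i + t)).coord v =
      (if v = w i then 1 - t else 0) + (if v = w (i + 1) then t else 0) := by
  rcases h1.lt_or_eq with h1 | rfl
  · have hfl : ⌊(i : ℝ) + t⌋₊ = i := by
      rw [Nat.floor_eq_iff (by positivity)]
      constructor <;> linarith
    have hfr : Int.fract ((i : ℝ) + t) = t := by
      rw [Int.fract_natCast_add, Int.fract_eq_self.2 ⟨h0, h1⟩]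
    simp only [walkCurve, edgePoint, hfl, hfr]
  · have hfl : ⌊(i : ℝ) + 1⌋₊ = i + 1 := by exact_mod_cast Nat.floor_natCast (R := ℝ) (i + 1)
    have hfr : Int.fract ((i : ℝ) + 1) = 0 := by
      exact_mod_cast Int.fract_natCast (R := ℝ) (i + 1)
    simp only [walkCurve, edgePoint, hfl, hfr]
    simp

theorem exists_eq_natCast_add {s : ℝ} (hs : 0 ≤ s) : ∃ (i : ℕ) (t : ℝ), 0 ≤ t ∧ t < 1 ∧ s = i + t :=
  ⟨⌊s⌋₊, s - ⌊s⌋₊, by linarith [Nat.floor_le hs], by linarith [Nat.lt_floor_add_one s], by ring⟩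

/-- The vertices of the edge of the point at time `s` are visited at times `j` with `|s - j| < 1`,
and `|s - j|` is the distance to them. -/
theorem exists_of_walkCurve_coord_ne_zero {s : ℝ} (hs : 0 ≤ s) {v : V}
    (hv : (walkCurve hG hw s).coord v ≠ 0) :
    ∃ j : ℕ, v = w j ∧ |s - j| < 1 ∧ 1 - (walkCurve hG hw s).coord v = |s - j| := by
  obtain ⟨i, t, h0, h1, rfl⟩ := exists_eq_natCast_add hs
  rw [walkCurve_coord hw i h0 h1.le] at hv ⊢
  by_cases hi : v = w i
  · have hi' : v ≠ w (i + 1) := fun h => (hw i).ne (hi.symm.trans h)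
    refine ⟨i, hi, ?_, ?_⟩ <;> rw [add_sub_cancel_left, abs_of_nonneg h0]
    · exact h1
    · rw [if_pos hi, if_neg hi']; ring
  · by_cases hi' : v = w (i + 1)
    · rw [if_neg hi, if_pos hi', zero_add] at hv ⊢
      have h0' : 0 < t := h0.lt_of_ne' hv
      have h2 : (i : ℝ) + t - ((i + 1 : ℕ) : ℝ) = -(1 - t) := by push_cast; ring
      refine ⟨i + 1, hi', ?_, ?_⟩ <;> rw [h2, abs_neg, abs_of_pos (by linarith)]
      linarith
    · simp [hi, hi'] at hv

theorem dist_walkCurve_le {s t : ℝ} (hs : 0 ≤ s) (hst : s ≤ t) :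
    dist (walkCurve hG hw s) (walkCurve hG hw t) ≤ t - s := by
  have hedge : ∀ (i : ℕ) (s t : ℝ), i ≤ s → s ≤ t → t ≤ i + 1 →
      dist (walkCurve hG hw s) (walkCurve hG hw t) ≤ t - s := by
    intro i s t h1 h2 h3
    have hcs := walkCurve_coord (hG := hG) hw i (t := s - i) (by linarith) (by linarith)
    have hct := walkCurve_coord (hG := hG) hw i (t := t - i) (by linarith) (by linarith)
    rw [add_sub_cancel] at hcs hct
    have h : ∀ v, v ≠ w i → v ≠ w (i + 1) →
        (walkCurve hG hw s).coord v = 0 ∧ (walkCurve hG hw t).coord v = 0 := by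
      intro v a b
      rw [hcs, hct]
      simp [a, b]
    refine (dist_le (Or.inr ⟨⟨_, _, hw i, h⟩, rfl⟩)).trans ?_
    rw [half_sum _ _ (hw i).ne h, hcs, hct]
    simp only [(hw i).ne, if_true, if_false, add_zero]
    rw [abs_of_nonneg] <;> linarith
  have hind : ∀ (N : ℕ) (s t : ℝ), 0 ≤ s → s ≤ t → t ≤ N →
      dist (walkCurve hG hw s) (walkCurve hG hw t) ≤ t - s := by
    intro N
    induction N with
    | zero =>
      intro s t h1 h2 h3
      exact hedge 0 s t (by simpa using h1) h2 (h3.trans (by norm_num))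
    | succ N ih =>
      intro s t h1 h2 h3
      push_cast at h3
      rcases le_total t N with h | h
      · exact ih s t h1 h2 h
      rcases le_total (N : ℝ) s with h' | h'
      · exact hedge N s t h' h2 h3
      · have a1 := ih s N h1 h' le_rfl
        have a2 := hedge N N t le_rfl h h3
        have a3 := dist_triangle (walkCurve hG hw s) (walkCurve hG hw N) (walkCurve hG hw t)
        linarith
  exact hind ⌈t⌉₊ s t hs hst (Nat.le_ceil t)

/-- A lower bound for the distance of two points that are not interior to the same edge, from
a function on the vertices that changes by at most `1` along an edge. -/
theorem le_dist_of_lipschitz {φ : V → ℝ} (hφ : ∀ u v, G.Adj u v → φ u ≤ φ v + 1)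
    {x y : MetricGraph G hG} {c : ℝ} (hx : ∀ u, x.coord u ≠ 0 → c - (1 - x.coord u) ≤ φ u)
    (hy : ∀ v, y.coord v ≠ 0 → φ v ≤ 1 - y.coord v)
    (hxy : ∀ a b, a ≠ b → x.coord a ≠ 0 → x.coord b ≠ 0 → y.coord a ≠ 0 → y.coord b ≠ 0 → False) :
    c ≤ dist x y := by
  rcases dist_cases x y with ⟨u, v, hu, hv, e⟩ | ⟨a, b, hab, h1, h2, h3, h4, -⟩
  · have := hG.le_add_dist_of_adj hφ u v
    linarith [hx u hu, hy v hv]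
  · exact (hxy a b hab.ne h1 h2 h3 h4).elim

end MetricGraph

/-! ### Graphs with a Hamiltonian cycle and hyperbolicity constant `n / 4` -/

namespace MetricGraph

variable {n : ℕ} [NeZero n] {G : SimpleGraph (Fin n)} {hG : G.Connected}

/-- Let the vertices in cyclic order form a cycle. The positions `a`, `a + n / 2` divide it into two
halves; `φ` and `ψ` are functions on the vertices, changing by at most `1` along edges, which bound
from below the distance of the two points and the distance of the middle of the first half from
the second half. -/
theorem card_div_four_le_of_cycle (hn : 2 ≤ n)
    (hw : ∀ i, G.Adj (Fin.ofNat n i) (Fin.ofNat n (i + 1)))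
    {φ ψ : Fin n → ℝ} (hφ : ∀ u v, G.Adj u v → φ u ≤ φ v + 1)
    (hψ : ∀ u v, G.Adj u v → ψ u ≤ ψ v + 1) {a : ℝ} (ha : 0 ≤ a)
    (hφ0 : ∀ j : ℕ, |a - j| < 1 → φ (Fin.ofNat n j) ≤ |a - j|)
    (hφ1 : ∀ j : ℕ, |a + n / 2 - j| < 1 → (n : ℝ) / 2 - |a + n / 2 - j| ≤ φ (Fin.ofNat n j))
    (hψ0 : ∀ j : ℕ, |a + n / 4 - j| < 1 → (n : ℝ) / 4 - |a + n / 4 - j| ≤ ψ (Fin.ofNat n j))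
    (hψ1 : ∀ (j : ℕ) (s : ℝ), a + n / 2 ≤ s → s ≤ a + n → |s - j| < 1 →
      ψ (Fin.ofNat n j) ≤ |s - j|)
    (hxy : ∀ i j k l : ℕ, Fin.ofNat n i ≠ Fin.ofNat n k → |a - i| < 1 → |a - k| < 1 →
      |a + n / 2 - j| < 1 → |a + n / 2 - l| < 1 →
      Fin.ofNat n i = Fin.ofNat n j → Fin.ofNat n k = Fin.ofNat n l → False)
    (hpq : ∀ (i j k l : ℕ) (s : ℝ), a + n / 2 ≤ s → s ≤ a + n → Fin.ofNat n i ≠ Fin.ofNat n k →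
      |a + n / 4 - i| < 1 → |a + n / 4 - k| < 1 → |s - j| < 1 → |s - l| < 1 →
      Fin.ofNat n i = Fin.ofNat n j → Fin.ofNat n k = Fin.ofNat n l → False) :
    (n : ℝ) / 4 ≤ hyperbolicityConstant (MetricGraph G hG) := by
  have hn0 : (0 : ℝ) ≤ n := Nat.cast_nonneg n
  have hn4 : (n : ℝ) / 4 = n / 2 / 2 := by ring
  have hdist : ∀ {χ : Fin n → ℝ} {c s t : ℝ}, (∀ u v, G.Adj u v → χ u ≤ χ v + 1) → 0 ≤ s → 0 ≤ t →
      (∀ j : ℕ, |s - j| < 1 → c - |s - j| ≤ χ (Fin.ofNat n j)) →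
      (∀ j : ℕ, |t - j| < 1 → χ (Fin.ofNat n j) ≤ |t - j|) →
      (∀ i j k l : ℕ, Fin.ofNat n i ≠ Fin.ofNat n k → |s - i| < 1 → |s - k| < 1 →
        |t - j| < 1 → |t - l| < 1 → Fin.ofNat n i = Fin.ofNat n j →
        Fin.ofNat n k = Fin.ofNat n l → False) →
      c ≤ dist (walkCurve hG hw s) (walkCurve hG hw t) := by
    intro χ c s t hχ hs ht h1 h2 h3
    refine le_dist_of_lipschitz hχ (fun u hu => ?_) (fun v hv => ?_) ?_
    · obtain ⟨j, rfl, hj, e⟩ := exists_of_walkCurve_coord_ne_zero hw hs hu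
      rw [e]
      exact h1 j hj
    · obtain ⟨j, rfl, hj, e⟩ := exists_of_walkCurve_coord_ne_zero hw ht hv
      rw [e]
      exact h2 j hj
    · intro u v huv hu hv hu' hv'
      obtain ⟨i, hi, hi1, -⟩ := exists_of_walkCurve_coord_ne_zero hw hs hu
      obtain ⟨k, hk, hk1, -⟩ := exists_of_walkCurve_coord_ne_zero hw hs hv
      obtain ⟨j, hj, hj1, -⟩ := exists_of_walkCurve_coord_ne_zero hw ht hu'
      obtain ⟨l, hl, hl1, -⟩ := exists_of_walkCurve_coord_ne_zero hw ht hv'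
      exact h3 i j k l (hi ▸ hk ▸ huv) hi1 hk1 hj1 hl1 (hi ▸ hj) (hk ▸ hl)
  have key := half_le_hyperbolicityConstant (X := MetricGraph G hG) (γ := walkCurve hG hw) (a := a)
    (L := n / 2) (by positivity) (fun s t h1 h2 _ => dist_walkCurve_le hw (by linarith) h2)
  rw [← hn4] at key
  refine key ?_ ?_ ?_ ?_
  · obtain ⟨i, t, h0, h1, rfl⟩ := exists_eq_natCast_add ha
    have hper : ∀ j, Fin.ofNat n (j + n) = Fin.ofNat n j := fun j => by
      ext; simp
    have h2 : (i : ℝ) + t + n / 2 + n / 2 = ((i + n : ℕ) : ℝ) + t := by push_cast; ring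
    ext v
    rw [h2, walkCurve_coord hw _ h0 h1.le, walkCurve_coord hw _ h0 h1.le, add_right_comm,
      hper, hper]
  · rw [dist_comm]
    exact hdist hφ (by positivity) ha hφ1 hφ0 fun i j k l h h1 h2 h3 h4 e1 e2 =>
      hxy j i l k (fun h' => h (e1.trans (h'.trans e2.symm))) h3 h4 h1 h2 e1.symm e2.symm
  · intro s hs
    have hs' : s ≤ a + n := by linarith [hs.2]
    exact hdist hψ (by positivity) (by linarith [hs.1]) hψ0
      (fun j => hψ1 j s hs.1 hs') fun i j k l => hpq i j k l s hs.1 hs'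
  · intro A B C hT
    simpa using isThinTriangle_card_div_four (hG := hG) (by simpa using hn) hT

end MetricGraph

/-! ### Edge counts of graphs with a Hamiltonian cycle -/

namespace MetricGraph

theorem natCast_bounds_of_abs_lt {j p q : ℕ} {x : ℝ} (hq : 0 < q) (hx : x * q = p)
    (h : |x - j| < 1) : p < q * j + q ∧ q * j < p + q := by
  have hq' : (0 : ℝ) < q := by exact_mod_cast hq
  obtain ⟨h1, h2⟩ := abs_lt.1 h
  have h3 : (p : ℝ) < q * j + q := by rw [← hx]; nlinarith
  have h4 : (q : ℝ) * j < p + q := by rw [← hx]; nlinarith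
  exact ⟨by exact_mod_cast h3, by exact_mod_cast h4⟩

theorem val_ofNat_of_le {n : ℕ} [NeZero n] {j : ℕ} (hj : j ≤ n) :
    (j < n ∧ (Fin.ofNat n j : Fin n).val = j) ∨ (j = n ∧ (Fin.ofNat n j : Fin n).val = 0) := by
  rcases hj.lt_or_eq with h | rfl
  · exact Or.inl ⟨h, by simp [Nat.mod_eq_of_lt h]⟩
  · exact Or.inr ⟨rfl, by simp⟩

/-- The edges of the cycle through all vertices in cyclic order. -/
def cycleEdges (n : ℕ) [NeZero n] : Finset (Sym2 (Fin n)) :=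
  (Finset.range n).image fun i => s(Fin.ofNat n i, Fin.ofNat n (i + 1))

theorem mem_cycleEdges {n : ℕ} [NeZero n] (i : ℕ) :
    s(Fin.ofNat n i, Fin.ofNat n (i + 1)) ∈ cycleEdges n := by
  refine Finset.mem_image.2 ⟨i % n, Finset.mem_range.2 (Nat.mod_lt _ (NeZero.pos n)), ?_⟩
  refine congrArg₂ (fun a b => s(a, b)) ?_ ?_ <;> (ext; simp)

theorem exists_of_mem_cycleEdges {n : ℕ} [NeZero n] {u v : Fin n} (h : s(u, v) ∈ cycleEdges n) :
    u.val + 1 = v.val ∨ v.val + 1 = u.val ∨ (u.val = 0 ∧ v.val + 1 = n) ∨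
      (v.val = 0 ∧ u.val + 1 = n) := by
  obtain ⟨i, hi, e⟩ := Finset.mem_image.1 h
  have hi := Finset.mem_range.1 hi
  have h1 := val_ofNat_of_le hi.le
  have h2 := val_ofNat_of_le (j := i + 1) hi
  rcases Sym2.eq_iff.1 e with ⟨rfl, rfl⟩ | ⟨rfl, rfl⟩ <;> omega

theorem card_cycleEdges {n : ℕ} [NeZero n] (hn : 3 ≤ n) : (cycleEdges n).card = n := by
  rw [cycleEdges, Finset.card_image_of_injOn, Finset.card_range]
  intro i hi j hj e
  have hi : i < n := by simpa using hi
  have hj : j < n := by simpa using hj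
  have h1 := val_ofNat_of_le hi.le
  have h2 := val_ofNat_of_le (j := i + 1) hi
  have h3 := val_ofNat_of_le hj.le
  have h4 := val_ofNat_of_le (j := j + 1) hj
  rcases Sym2.eq_iff.1 e with ⟨e1, e2⟩ | ⟨e1, e2⟩ <;>
    rw [Fin.ext_iff] at e1 e2 <;> omega

/-- Between the cycle and a larger set of edges there are graphs with any number of edges. -/
theorem exists_connected_of_cycleEdges_subset {n m : ℕ} [NeZero n] (hn : 3 ≤ n)
    {T : Finset (Sym2 (Fin n))} (hT : cycleEdges n ⊆ T) (hnm : n ≤ m) (hm : m ≤ T.card)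
    (hdiag : ∀ e ∈ T, ¬ e.IsDiag) :
    ∃ G : SimpleGraph (Fin n), G.Connected ∧ G.edgeSet.ncard = m ∧
      (∀ i, G.Adj (Fin.ofNat n i) (Fin.ofNat n (i + 1))) ∧ ∀ u v, G.Adj u v → s(u, v) ∈ T := by
  obtain ⟨E, h1, h2, h3⟩ :=
    Finset.exists_subsuperset_card_eq hT ((card_cycleEdges hn).trans_le hnm) hm
  have hE : (SimpleGraph.fromEdgeSet (E : Set (Sym2 (Fin n)))).edgeSet = E := by
    rw [SimpleGraph.edgeSet_fromEdgeSet, sdiff_eq_left, Set.disjoint_left]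
    exact fun e he => hdiag e (h2 he)
  have hadj : ∀ u v, (SimpleGraph.fromEdgeSet (E : Set (Sym2 (Fin n)))).Adj u v ↔ s(u, v) ∈ E := by
    intro u v
    rw [← SimpleGraph.mem_edgeSet, hE, Finset.mem_coe]
  have hcyc := fun i => (hadj _ _).2 (h1 (mem_cycleEdges (n := n) i))
  refine ⟨_, ?_, by rw [hE, Set.ncard_coe_finset, h3], hcyc, fun u v h => h2 ((hadj u v).1 h)⟩
  have hreach : ∀ i, (SimpleGraph.fromEdgeSet (E : Set (Sym2 (Fin n)))).Reachable
      (Fin.ofNat n 0) (Fin.ofNat n i) := by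
    intro i
    induction i with
    | zero => rfl
    | succ i ih => exact ih.trans (hcyc i).reachable
  have hval : ∀ u : Fin n, Fin.ofNat n u.val = u := fun u => by
    ext; simp
  rw [SimpleGraph.connected_iff]
  refine ⟨fun u v => ?_, ⟨Fin.ofNat n 0⟩⟩
  rw [← hval u, ← hval v]
  exact (hreach _).symm.trans (hreach _)

/-- Starting at the vertex `0`: the chords may join `1` with the two vertices before `0`, and two
vertices around the opposite point. -/
theorem card_div_four_le_of_chords {n : ℕ} [NeZero n] (hn : 3 ≤ n) {G : SimpleGraph (Fin n)}
    {hG : G.Connected} (hw : ∀ i, G.Adj (Fin.ofNat n i) (Fin.ofNat n (i + 1)))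
    (hφ : ∀ u v : Fin n, G.Adj u v →
      min (u.val : ℝ) (n - u.val) ≤ min (v.val : ℝ) (n - v.val) + 1)
    (hψ : ∀ u v : Fin n, G.Adj u v →
      max 0 (min (u.val : ℝ) (n / 2 - u.val)) ≤ max 0 (min (v.val : ℝ) (n / 2 - v.val)) + 1) :
    (n : ℝ) / 4 ≤ hyperbolicityConstant (MetricGraph G hG) := by
  have hn' : (3 : ℝ) ≤ n := by exact_mod_cast hn
  have hval : ∀ j : ℕ, j < n → (Fin.ofNat n j : Fin n).val = j := fun j hj => by
    simp [Nat.mod_eq_of_lt hj]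
  refine card_div_four_le_of_cycle (by omega) hw hφ hψ (a := 0) le_rfl ?_ ?_ ?_ ?_ ?_ ?_
  · intro j hj
    obtain ⟨-, h2⟩ := natCast_bounds_of_abs_lt (p := 0) (q := 1) one_pos (by simp) hj
    obtain rfl : j = 0 := by omega
    rw [hval 0 (by omega)]
    simp
  · intro j hj
    obtain ⟨-, h2⟩ := natCast_bounds_of_abs_lt (p := n) (q := 2) two_pos
      (by push_cast; ring) hj
    rw [hval j (by omega), zero_add]
    have h3 := neg_abs_le ((n : ℝ) / 2 - j)
    have h4 := le_abs_self ((n : ℝ) / 2 - j)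
    exact le_min (by linarith) (by linarith)
  · intro j hj
    obtain ⟨-, h2⟩ := natCast_bounds_of_abs_lt (p := n) (q := 4) four_pos
      (by push_cast; ring) hj
    rw [hval j (by omega), zero_add]
    have h3 := neg_abs_le ((n : ℝ) / 4 - j)
    have h4 := le_abs_self ((n : ℝ) / 4 - j)
    exact le_max_of_le_right (le_min (by linarith) (by linarith))
  · intro j s hs1 hs2 hj
    have h1 : j < n + 1 := by
      have : (j : ℝ) < n + 1 := by linarith [(abs_lt.1 hj).1]
      exact_mod_cast this
    refine max_le (abs_nonneg _) ?_
    rcases val_ofNat_of_le (Nat.lt_succ_iff.1 h1) with ⟨-, e⟩ | ⟨-, e⟩ <;> rw [e]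
    · exact (min_le_right _ _).trans (by linarith [le_abs_self (s - j)])
    · exact (min_le_left _ _).trans (by simp)
  · intro i j k l hik hi hk _ _ _ _
    obtain ⟨-, h2⟩ := natCast_bounds_of_abs_lt (p := 0) (q := 1) one_pos (by simp) hi
    obtain ⟨-, h3⟩ := natCast_bounds_of_abs_lt (p := 0) (q := 1) one_pos (by simp) hk
    exact hik (by rw [show i = k by omega])
  · intro i j k l s hs1 hs2 hik hi hk hj hl hij hkl
    obtain ⟨i1, i2⟩ := natCast_bounds_of_abs_lt (p := n) (q := 4) four_pos
      (by push_cast; ring) hi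
    obtain ⟨k1, k2⟩ := natCast_bounds_of_abs_lt (p := n) (q := 4) four_pos
      (by push_cast; ring) hk
    obtain ⟨j1, j2⟩ := abs_lt.1 hj
    obtain ⟨l1, l2⟩ := abs_lt.1 hl
    have a1 : j < n + 1 := by
      have : (j : ℝ) < n + 1 := by linarith
      exact_mod_cast this
    have a2 : l < n + 1 := by
      have : (l : ℝ) < n + 1 := by linarith
      exact_mod_cast this
    have a3 : j < l + 2 := by
      have : (j : ℝ) < l + 2 := by linarith
      exact_mod_cast this
    have a4 : l < j + 2 := by
      have : (l : ℝ) < j + 2 := by linarith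
      exact_mod_cast this
    have a5 : n < 2 * j + 2 := by
      have : (n : ℝ) < 2 * j + 2 := by linarith
      exact_mod_cast this
    have a6 : n < 2 * l + 2 := by
      have : (n : ℝ) < 2 * l + 2 := by linarith
      exact_mod_cast this
    have e1 := hval i (by omega)
    have e2 := hval k (by omega)
    have e3 := val_ofNat_of_le (Nat.lt_succ_iff.1 a1)
    have e4 := val_ofNat_of_le (Nat.lt_succ_iff.1 a2)
    rw [Fin.ext_iff] at hij hkl
    rw [Ne, Fin.ext_iff] at hik
    omega

/-- On four vertices no chord is an obstacle, if one starts in the middle of an edge. -/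
theorem one_le_hyperbolicityConstant_of_four {G : SimpleGraph (Fin 4)} {hG : G.Connected}
    (hw : ∀ i, G.Adj (Fin.ofNat 4 i) (Fin.ofNat 4 (i + 1))) :
    1 ≤ hyperbolicityConstant (MetricGraph G hG) := by
  have key := card_div_four_le_of_cycle (hG := hG) (by norm_num) hw
    (φ := fun v => if v.val < 2 then 1 / 2 else 3 / 2)
    (ψ := fun v => if v.val = 1 ∨ v.val = 2 then 1 / 2 else 0) (a := 1 / 2)
    (fun u v _ => by split_ifs <;> norm_num) (fun u v _ => by split_ifs <;> norm_num)
    (by norm_num) ?_ ?_ ?_ ?_ ?_ ?_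
  · simpa using key
  · intro j hj
    obtain ⟨h1, h2⟩ := natCast_bounds_of_abs_lt (p := 1) (q := 2) two_pos (by norm_num) hj
    obtain rfl | rfl : j = 0 ∨ j = 1 := by omega
    all_goals norm_num
  · intro j hj
    obtain ⟨h1, h2⟩ := natCast_bounds_of_abs_lt (p := 5) (q := 2) two_pos (by norm_num) hj
    obtain rfl | rfl : j = 2 ∨ j = 3 := by omega
    all_goals norm_num
  · intro j hj
    obtain ⟨h1, h2⟩ := natCast_bounds_of_abs_lt (p := 3) (q := 2) two_pos (by norm_num) hj
    obtain rfl | rfl : j = 1 ∨ j = 2 := by omega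
    all_goals norm_num
  · intro j s hs1 hs2 hj
    norm_num at hs1 hs2
    obtain ⟨j1, j2⟩ := abs_lt.1 hj
    have h1 : 3 < 2 * j := by
      have : (3 : ℝ) < 2 * j := by linarith
      exact_mod_cast this
    have h2 : 2 * j < 11 := by
      have : 2 * (j : ℝ) < 11 := by linarith
      exact_mod_cast this
    obtain rfl | rfl | rfl | rfl : j = 2 ∨ j = 3 ∨ j = 4 ∨ j = 5 := by omega
    · norm_num
      exact le_trans (by linarith) (le_abs_self _)
    · norm_num
    · norm_num
    · norm_num
      exact le_trans (by linarith) (neg_le_abs _)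
  · intro i j k l hik hi hk hj hl hij hkl
    have h1 := natCast_bounds_of_abs_lt (p := 1) (q := 2) two_pos (by norm_num) hi
    have h2 := natCast_bounds_of_abs_lt (p := 5) (q := 2) two_pos (by norm_num) hj
    rw [Fin.ext_iff, Fin.val_ofNat, Fin.val_ofNat] at hij
    omega
  · intro i j k l s hs1 hs2 hik hi hk hj hl hij hkl
    norm_num at hs1 hs2
    obtain ⟨j1, j2⟩ := abs_lt.1 hj
    obtain ⟨l1, l2⟩ := abs_lt.1 hl
    have h1 := natCast_bounds_of_abs_lt (p := 3) (q := 2) two_pos (by norm_num) hi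
    have h2 := natCast_bounds_of_abs_lt (p := 3) (q := 2) two_pos (by norm_num) hk
    have a1 : 3 < 2 * j := by
      have : (3 : ℝ) < 2 * j := by linarith
      exact_mod_cast this
    have a2 : 2 * j < 11 := by
      have : 2 * (j : ℝ) < 11 := by linarith
      exact_mod_cast this
    have a3 : j < l + 2 := by
      have : (j : ℝ) < l + 2 := by linarith
      exact_mod_cast this
    have a4 : l < j + 2 := by
      have : (l : ℝ) < j + 2 := by linarith
      exact_mod_cast this
    have a5 : 2 * l < 11 := by
      have : 2 * (l : ℝ) < 11 := by linarith
      exact_mod_cast this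
    have a6 : 3 < 2 * l := by
      have : (3 : ℝ) < 2 * l := by linarith
      exact_mod_cast this
    rw [Fin.ext_iff, Fin.val_ofNat, Fin.val_ofNat] at hij hkl
    rw [Ne, Fin.ext_iff, Fin.val_ofNat, Fin.val_ofNat] at hik
    omega

/-- Three chords of the cycle that keep the hyperbolicity constant at `n / 4`. -/
def shortChords (n : ℕ) [NeZero n] : Finset (Sym2 (Fin n)) :=
  {s(Fin.ofNat n 1, Fin.ofNat n (n - 1)), s(Fin.ofNat n 1, Fin.ofNat n (n - 2)),
    s(Fin.ofNat n ((n - 1) / 2), Fin.ofNat n ((n - 1) / 2 + 2))}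

theorem val_of_mem_shortChords {n : ℕ} [NeZero n] (hn : 5 ≤ n) {u v : Fin n}
    (h : s(u, v) ∈ shortChords n) :
    (u.val = 1 ∧ v.val = n - 1) ∨ (v.val = 1 ∧ u.val = n - 1) ∨
    (u.val = 1 ∧ v.val = n - 2) ∨ (v.val = 1 ∧ u.val = n - 2) ∨
    (u.val = (n - 1) / 2 ∧ v.val = (n - 1) / 2 + 2) ∨
    (v.val = (n - 1) / 2 ∧ u.val = (n - 1) / 2 + 2) := by
  have hval : ∀ j : ℕ, j < n → (Fin.ofNat n j : Fin n).val = j := fun j hj => by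
    simp [Nat.mod_eq_of_lt hj]
  have h1 := hval 1 (by omega)
  have h2 := hval (n - 1) (by omega)
  have h3 := hval (n - 2) (by omega)
  have h4 := hval ((n - 1) / 2) (by omega)
  have h5 := hval ((n - 1) / 2 + 2) (by omega)
  simp only [shortChords, Finset.mem_insert, Finset.mem_singleton, Sym2.eq_iff, Fin.ext_iff] at h
  omega

theorem card_cycleEdges_union_shortChords {n : ℕ} [NeZero n] (hn : 5 ≤ n) :
    (cycleEdges n ∪ shortChords n).card = n + 3 := by
  have hval : ∀ j : ℕ, j < n → (Fin.ofNat n j : Fin n).val = j := fun j hj => by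
    simp [Nat.mod_eq_of_lt hj]
  have h1 := hval 1 (by omega)
  have h2 := hval (n - 1) (by omega)
  have h3 := hval (n - 2) (by omega)
  have h4 := hval ((n - 1) / 2) (by omega)
  have h5 := hval ((n - 1) / 2 + 2) (by omega)
  rw [Finset.card_union_of_disjoint, card_cycleEdges (by omega), shortChords,
    Finset.card_insert_of_notMem, Finset.card_pair]
  · simp only [Ne, Sym2.eq_iff, Fin.ext_iff]
    omega
  · simp only [Finset.mem_insert, Finset.mem_singleton, Sym2.eq_iff, Fin.ext_iff]
    omega
  · rw [Finset.disjoint_left]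
    intro e
    induction e with
    | _ u v =>
      intro h h'
      have a1 := exists_of_mem_cycleEdges h
      have a2 := val_of_mem_shortChords hn h'
      omega

/-- Two functions change by at most `1` along the cycle and along the short chords: the distance on
the cycle to the vertex `0`, and the distance to the nearer end of the first half of the cycle
(extended by zero to the second half). -/
theorem lipschitz_of_mem {n : ℕ} [NeZero n] (hn : 3 ≤ n) {u v : Fin n}
    (h : s(u, v) ∈ cycleEdges n ∨ (5 ≤ n ∧ s(u, v) ∈ shortChords n)) :
    min (u.val : ℝ) (n - u.val) ≤ min (v.val : ℝ) (n - v.val) + 1 ∧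
    max 0 (min (u.val : ℝ) (n / 2 - u.val)) ≤ max 0 (min (v.val : ℝ) (n / 2 - v.val)) + 1 := by
  have hu := u.isLt
  have hv := v.isLt
  -- cleared of denominators, both claims are about natural numbers
  have key : min u.val (n - u.val) ≤ min v.val (n - v.val) + 1 ∧
      min (2 * u.val) (n - 2 * u.val) ≤ min (2 * v.val) (n - 2 * v.val) + 2 := by
    rcases h with h | ⟨h5, h⟩
    · have := exists_of_mem_cycleEdges h
      omega
    · have := val_of_mem_shortChords h5 h
      omega
  have hcast : ∀ k : ℕ, ((n - k : ℕ) : ℝ) = max 0 ((n : ℝ) - k) := by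
    intro k
    rcases le_total k n with h | h
    · rw [Nat.cast_sub h, max_eq_right]
      have : (k : ℝ) ≤ n := by exact_mod_cast h
      linarith
    · rw [Nat.sub_eq_zero_of_le h, max_eq_left, Nat.cast_zero]
      have : (n : ℝ) ≤ k := by exact_mod_cast h
      linarith
  have hφ : ∀ k : ℕ, k < n → ((min k (n - k) : ℕ) : ℝ) = min (k : ℝ) (n - k) := by
    intro k hk
    rw [Nat.cast_min, Nat.cast_sub hk.le]
  have hψ : ∀ k : ℕ, ((min (2 * k) (n - 2 * k) : ℕ) : ℝ) = 2 * max 0 (min (k : ℝ) (n / 2 - k)) := by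
    intro k
    have hk : (0 : ℝ) ≤ k := Nat.cast_nonneg k
    rw [Nat.cast_min, hcast, mul_max_of_nonneg _ _ zero_le_two, mul_min_of_nonneg _ _ zero_le_two,
      mul_zero, max_min_distrib_left]
    push_cast
    rw [max_eq_right (by linarith : (0 : ℝ) ≤ 2 * k)]
    congr 2
    ring
  constructor
  · rw [← hφ _ hu, ← hφ _ hv]
    exact_mod_cast key.1
  · have : ((min (2 * u.val) (n - 2 * u.val) : ℕ) : ℝ) ≤
        ((min (2 * v.val) (n - 2 * v.val) : ℕ) : ℝ) + 2 := by exact_mod_cast key.2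
    rw [hψ, hψ] at this
    linarith

theorem exists_card_div_four_le {n m : ℕ} (hn : 3 ≤ n) (h1 : n ≤ m) (h2 : m ≤ n + 3)
    (h3 : m ≤ n.choose 2) : ∃ (G : SimpleGraph (Fin n)) (hG : G.Connected),
      G.edgeSet.ncard = m ∧ (n : ℝ) / 4 ≤ hyperbolicityConstant (MetricGraph G hG) := by
  have : NeZero n := ⟨by omega⟩
  have hdiag : ∀ e ∈ cycleEdges n, ¬ e.IsDiag := by
    intro e
    induction e with
    | _ u v =>
      intro he hd
      have := exists_of_mem_cycleEdges he
      rw [Sym2.mk_isDiag_iff] at hd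
      subst hd
      omega
  -- for `n = 4` two of the three chords of the general construction degenerate
  by_cases h4 : n = 4
  · subst h4
    let T : Finset (Sym2 (Fin 4)) := Finset.univ.filter fun e => ¬ e.IsDiag
    obtain ⟨G, hG, hcard, hcyc, -⟩ := exists_connected_of_cycleEdges_subset (T := T) hn
      (fun e he => Finset.mem_filter.2 ⟨Finset.mem_univ _, hdiag e he⟩) h1
      (h3.trans_eq (by decide)) (fun e he => (Finset.mem_filter.1 he).2)
    refine ⟨G, hG, hcard, ?_⟩
    have := one_le_hyperbolicityConstant_of_four (hG := hG) hcyc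
    norm_num
    exact this
  · obtain ⟨T, hT, hm, hTmem⟩ : ∃ T, cycleEdges n ⊆ T ∧ m ≤ T.card ∧
        ∀ e ∈ T, e ∈ cycleEdges n ∨ (5 ≤ n ∧ e ∈ shortChords n) := by
      by_cases h5 : 5 ≤ n
      · exact ⟨cycleEdges n ∪ shortChords n, Finset.subset_union_left,
          h2.trans_eq (card_cycleEdges_union_shortChords h5).symm,
          fun e he => (Finset.mem_union.1 he).imp_right fun h => ⟨h5, h⟩⟩
      · obtain rfl : n = 3 := by omega
        exact ⟨cycleEdges 3, subset_rfl, by rw [card_cycleEdges hn]; simpa using h3,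
          fun e he => Or.inl he⟩
    have hdiag' : ∀ e ∈ T, ¬ e.IsDiag := by
      intro e
      induction e with
      | _ u v =>
        intro he
        rcases hTmem _ he with h | ⟨h5, h⟩
        · exact hdiag _ h
        · have := val_of_mem_shortChords h5 h
          rw [Sym2.mk_isDiag_iff]
          rintro rfl
          omega
    obtain ⟨G, hG, hcard, hcyc, hsub⟩ := exists_connected_of_cycleEdges_subset hn hT h1 hm hdiag'
    exact ⟨G, hG, hcard, card_div_four_le_of_chords hn hcyc
      (fun u v h => (lipschitz_of_mem hn (hTmem _ (hsub u v h))).1)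
      (fun u v h => (lipschitz_of_mem hn (hTmem _ (hsub u v h))).2)⟩

end MetricGraph

/-! ### Edges that are missing because of the distance layers -/

section Layers

variable {V : Type*} [Fintype V]

open Classical in
/-- In a connected graph with `r` layers around `w` (the `r`-th consisting of all vertices at
distance at least `r`), two vertices whose layers are not consecutive are not adjacent, so that
at least `f_r` of the layer sizes many edges are missing. -/
theorem SimpleGraph.Connected.card_add_missingEdges_le {G : SimpleGraph V} (hG : G.Connected)
    (w : V) (r : ℕ) :
    (G.edgeSet.ncard : ℝ) +
      missingEdges r (fun j => (Finset.univ.filter fun v => min (G.dist v w) r = j).card) ≤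
      (Fintype.card V).choose 2 := by
  set l : V → ℕ := fun v => min (G.dist v w) r with hl
  let P : Finset (V × V) := Finset.univ.filter fun p => l p.2 + 2 ≤ l p.1
  have hP :
      missingEdges r (fun j => ((Finset.univ.filter fun v => l v = j).card : ℝ)) = P.card := by
    have h1 : P.card = ∑ t ∈ Finset.Icc 2 r, (P.filter fun p => l p.1 = t).card := by
      refine Finset.card_eq_sum_card_fiberwise fun p hp => ?_
      have hp := (Finset.mem_filter.1 hp).2
      exact Finset.mem_coe.2 (Finset.mem_Icc.2 ⟨by omega, min_le_right _ _⟩)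
    rw [h1, missingEdges]
    push_cast
    refine Finset.sum_congr rfl fun t ht => ?_
    have h2 : (P.filter fun p => l p.1 = t) = (Finset.univ.filter fun v => l v = t) ×ˢ
        (Finset.univ.filter fun v => l v ∈ Finset.range (t - 1)) := by
      ext ⟨u, v⟩
      have := (Finset.mem_Icc.1 ht).1
      simp only [P, Finset.mem_filter, Finset.mem_product, Finset.mem_univ, true_and,
        Finset.mem_range]
      omega
    have h3 : (Finset.univ.filter fun v => l v ∈ Finset.range (t - 1)).card =
        ∑ s ∈ Finset.range (t - 1), (Finset.univ.filter fun v => l v = s).card := by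
      rw [Finset.card_eq_sum_card_fiberwise (f := l) (t := Finset.range (t - 1))
        fun v hv => by simpa using hv]
      refine Finset.sum_congr rfl fun s hs => ?_
      congr 1
      ext v
      simp only [Finset.mem_filter, Finset.mem_univ, true_and, and_iff_right_iff_imp]
      rintro rfl
      exact hs
    rw [h2, Finset.card_product, h3]
    push_cast
    rfl
  have hinj : Set.InjOn (fun p : V × V => s(p.1, p.2)) P := by
    rintro ⟨a, b⟩ h1 ⟨c, d⟩ h2 e
    have h1 : l b + 2 ≤ l a := (Finset.mem_filter.1 h1).2
    have h2 : l d + 2 ≤ l c := (Finset.mem_filter.1 h2).2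
    have e : s(a, b) = s(c, d) := e
    rcases Sym2.eq_iff.1 e with ⟨rfl, rfl⟩ | ⟨rfl, rfl⟩
    · rfl
    · omega
  have hdisj : Disjoint G.edgeFinset (P.image fun p : V × V => s(p.1, p.2)) := by
    rw [Finset.disjoint_right]
    intro e he hG'
    obtain ⟨⟨a, b⟩, hab, rfl⟩ := Finset.mem_image.1 he
    have h1 : min (G.dist b w) r + 2 ≤ min (G.dist a w) r := (Finset.mem_filter.1 hab).2
    have h2 : G.Adj a b := by simpa using hG'
    have h3 : G.dist a w ≤ G.dist a b + G.dist b w := hG.dist_triangle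
    rw [SimpleGraph.dist_eq_one_iff_adj.2 h2] at h3
    omega
  have hsub : G.edgeFinset ∪ (P.image fun p : V × V => s(p.1, p.2)) ⊆
      (⊤ : SimpleGraph V).edgeFinset := by
    refine Finset.union_subset (SimpleGraph.edgeFinset_mono le_top) fun e he => ?_
    obtain ⟨⟨a, b⟩, hab, rfl⟩ := Finset.mem_image.1 he
    have h1 : l b + 2 ≤ l a := (Finset.mem_filter.1 hab).2
    rw [SimpleGraph.mem_edgeFinset, SimpleGraph.mem_edgeSet, SimpleGraph.top_adj]
    intro hab'
    have hab' : a = b := hab'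
    subst hab'
    omega
  have hcard := Finset.card_le_card hsub
  rw [Finset.card_union_of_disjoint hdisj, Finset.card_image_of_injOn hinj,
    SimpleGraph.card_edgeFinset_top_eq_card_choose_two] at hcard
  rw [hP, ← SimpleGraph.coe_edgeFinset, Set.ncard_coe_finset]
  exact_mod_cast hcard

open Classical in
theorem SimpleGraph.Connected.layers_mem_layerSizes {G : SimpleGraph V} (hG : G.Connected)
    {w : V} {r : ℕ} (hr : 1 ≤ r)
    (h : ∀ j, 1 ≤ j → j < r → ∃ u v, u ≠ v ∧ G.dist u w = j ∧ G.dist v w = j)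
    (hfar : ∃ u, r ≤ G.dist u w) :
    (fun j => ((Finset.univ.filter fun v => min (G.dist v w) r = j).card : ℝ)) ∈
      layerSizes (Fintype.card V) r := by
  refine ⟨?_, fun j h1 h2 => ?_, ?_, ?_⟩
  · have : (Finset.univ.filter fun v => min (G.dist v w) r = 0) = {w} := by
      ext v
      rw [Finset.mem_filter, Finset.mem_singleton, ← hG.dist_eq_zero_iff]
      simp only [Finset.mem_univ, true_and]
      omega
    simp only [this]
    simp
  · obtain ⟨u, v, huv, hu, hv⟩ := h j h1 h2
    have : 1 < (Finset.univ.filter fun v => min (G.dist v w) r = j).card := by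
      refine Finset.one_lt_card.2 ⟨u, ?_, v, ?_, huv⟩ <;>
        rw [Finset.mem_filter] <;> refine ⟨Finset.mem_univ _, ?_⟩ <;> omega
    show (2 : ℝ) ≤ ((Finset.univ.filter fun v => min (G.dist v w) r = j).card : ℝ)
    exact_mod_cast this
  · obtain ⟨u, hu⟩ := hfar
    have : 0 < (Finset.univ.filter fun v => min (G.dist v w) r = r).card :=
      Finset.card_pos.2 ⟨u, Finset.mem_filter.2 ⟨Finset.mem_univ _, min_eq_right hu⟩⟩
    show (1 : ℝ) ≤ ((Finset.univ.filter fun v => min (G.dist v w) r = r).card : ℝ)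
    exact_mod_cast this
  · have := Finset.card_eq_sum_card_fiberwise (s := (Finset.univ : Finset V))
      (f := fun v => min (G.dist v w) r) (t := Finset.range (r + 1))
      fun v _ => by simp
    rw [← Finset.card_univ, this]
    push_cast
    rfl

end Layers

/-! ### The minimum of `f_r` -/

theorem missingEdges_succ {r : ℕ} (hr : 1 ≤ r) (k : ℕ → ℝ) :
    missingEdges (r + 1) k = missingEdges r k + k (r + 1) * ∑ s ∈ Finset.range r, k s := by
  rw [missingEdges, Finset.sum_Icc_succ_top (by omega)]
  rfl

theorem missingEdges_two (k : ℕ → ℝ) : missingEdges 2 k = k 2 * k 0 := by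
  simp [missingEdges]

theorem le_sum_range {k : ℕ → ℝ} {r R : ℕ} (h0 : k 0 = 1) (h : ∀ j, 1 ≤ j → j < r → 2 ≤ k j)
    (hR : 1 ≤ R) (hRr : R ≤ r) : 2 * (R : ℝ) - 1 ≤ ∑ s ∈ Finset.range R, k s := by
  induction R, hR using Nat.le_induction with
  | base => simp [h0]; norm_num
  | succ R hR ih =>
    rw [Finset.sum_range_succ]
    have := ih (by omega)
    have := h R hR (by omega)
    push_cast
    linarith

/-- The excess of the first `R` layer sizes over `1, 2, ..., 2` enters `f_R` with the factor
`2 * R - 5` at least, and the excess of the last one with the factor `2 * R - 3`. -/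
theorem le_missingEdges {k : ℕ → ℝ} {r R : ℕ} (h0 : k 0 = 1)
    (h : ∀ j, 1 ≤ j → j < r → 2 ≤ k j) (hR : 2 ≤ R) (hRr : R < r) :
    2 * ((R : ℝ) - 1) ^ 2 + (2 * R - 5) * ((∑ s ∈ Finset.range R, k s) - (2 * R - 1)) +
      (2 * R - 3) * (k R - 2) ≤ missingEdges R k := by
  induction R, hR using Nat.le_induction with
  | base =>
    rw [missingEdges_two]
    have := h 1 le_rfl (by omega)
    simp [Finset.sum_range_succ, h0]
    linarith
  | succ R hR ih =>
    rw [missingEdges_succ (by omega), Finset.sum_range_succ]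
    have h1 := ih (by omega)
    have h2 := le_sum_range h0 h (R := R) (by omega) (by omega)
    have h3 := h (R + 1) (by omega) hRr
    have h4 := mul_nonneg (sub_nonneg.2 h3) (sub_nonneg.2 h2)
    push_cast
    linarith

theorem le_missingEdges_of_mem_layerSizes {k : ℕ → ℝ} {n r : ℕ} (hr : 3 ≤ r)
    (hk : k ∈ layerSizes n r) :
    2 * (n : ℝ) * ((r : ℝ) - 3) - 2 * (r : ℝ) ^ 2 + 6 * (r : ℝ) + 5 ≤ missingEdges r k := by
  obtain ⟨h0, h, hkr, hsum⟩ := hk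
  obtain ⟨R, rfl⟩ : ∃ R, r = R + 1 := ⟨r - 1, by omega⟩
  rw [Finset.sum_range_succ, Finset.sum_range_succ] at hsum
  rw [missingEdges_succ (by omega), ← hsum]
  have hR : (2 : ℝ) ≤ R := by exact_mod_cast (by omega : 2 ≤ R)
  have h1 := le_missingEdges h0 h (R := R) (by omega) (by omega)
  have h2 := le_sum_range h0 h (R := R) (by omega) (by omega)
  have h3 := h R (by omega) (by omega)
  have h4 := mul_nonneg (sub_nonneg.2 hkr) (sub_nonneg.2 h2)
  push_cast
  linarith

/-- The sizes `1, 2, ..., 2, 1`, with all remaining vertices added to the layer `i`. They attain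
the minimum of `f_r` for `i = 1` if `r = 2`, and for `i = 2` if `r ≥ 3`. -/
def minimalLayers (n r i j : ℕ) : ℝ :=
  if j = 0 ∨ j = r then 1 else if j = i then n - 2 * r + 2 else 2

theorem sum_minimalLayers {n r i R : ℕ} (hi : 1 ≤ i) (hR : i < R) (hRr : R ≤ r) :
    ∑ s ∈ Finset.range R, minimalLayers n r i s = 2 * R - 1 + (n - 2 * r) := by
  have hlow : ∀ R : ℕ, 1 ≤ R → R ≤ i →
      ∑ s ∈ Finset.range R, minimalLayers n r i s = 2 * R - 1 := by
    intro R hR1 hRi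
    induction R, hR1 using Nat.le_induction with
    | base => simp [minimalLayers]; norm_num
    | succ R hR1 ih =>
      rw [Finset.sum_range_succ, ih (by omega), minimalLayers, if_neg (by omega), if_neg (by omega)]
      push_cast
      ring
  induction R, (Nat.succ_le_of_lt hR) using Nat.le_induction with
  | base =>
    rw [Finset.sum_range_succ, hlow i hi le_rfl, minimalLayers, if_neg (by omega), if_pos rfl]
    push_cast
    ring
  | succ R hR1 ih =>
    rw [Finset.sum_range_succ, ih (by omega) (by omega), minimalLayers, if_neg (by omega),
      if_neg (by omega)]
    push_cast
    ring

theorem minimalLayers_mem {n r i : ℕ} (hi : 1 ≤ i) (hir : i < r) (hn : 2 * r ≤ n) :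
    minimalLayers n r i ∈ layerSizes n r := by
  have hn' : (2 : ℝ) * r ≤ n := by exact_mod_cast hn
  refine ⟨by simp [minimalLayers], fun j h1 h2 => ?_, by simp [minimalLayers], ?_⟩
  · rw [minimalLayers, if_neg (by omega)]
    split_ifs <;> linarith
  · rw [Finset.sum_range_succ, sum_minimalLayers hi hir le_rfl, minimalLayers,
      if_pos (Or.inr rfl)]
    ring

theorem missingEdges_minimalLayers_two {n r : ℕ} (hr : 3 ≤ r) :
    missingEdges 2 (minimalLayers n r 2) = n - 2 * r + 2 := by
  have h0 : minimalLayers n r 2 0 = 1 := if_pos (Or.inl rfl)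
  rw [missingEdges_two, h0, minimalLayers, if_neg (by omega), if_pos rfl, mul_one]

theorem missingEdges_minimalLayers_of_lt {n r R : ℕ} (hR : 3 ≤ R) (hRr : R < r) :
    missingEdges R (minimalLayers n r 2) =
      2 * ((R : ℝ) - 1) ^ 2 + (2 * R - 5) * (n - 2 * r) := by
  induction R, hR using Nat.le_induction with
  | base =>
    rw [missingEdges_succ (by norm_num), missingEdges_minimalLayers_two (by omega)]
    have h0 : minimalLayers n r 2 0 = 1 := if_pos (Or.inl rfl)
    have h1 : minimalLayers n r 2 1 = 2 := by
      rw [minimalLayers, if_neg (by omega), if_neg (by omega)]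
    rw [Finset.sum_range_succ, Finset.sum_range_one, h0, h1, minimalLayers, if_neg (by omega),
      if_neg (by omega)]
    push_cast
    ring
  | succ R hR ih =>
    rw [missingEdges_succ (by omega), ih (by omega),
      sum_minimalLayers (by norm_num) (by omega) (by omega), minimalLayers, if_neg (by omega),
      if_neg (by omega)]
    push_cast
    ring

theorem isLeast_missingEdges_two {n : ℕ} (hn : 4 ≤ n) :
    IsLeast (missingEdges 2 '' layerSizes n 2) 1 := by
  constructor
  · refine ⟨_, minimalLayers_mem (i := 1) le_rfl (by norm_num) (by omega), ?_⟩
    simp [missingEdges_two, minimalLayers]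
  · rintro _ ⟨k, ⟨h0, -, h2, -⟩, rfl⟩
    rw [missingEdges_two, h0, mul_one]
    exact h2

theorem isLeast_missingEdges_three {n : ℕ} (hn : 6 ≤ n) :
    IsLeast (missingEdges 3 '' layerSizes n 3) (n - 1) := by
  constructor
  · refine ⟨_, minimalLayers_mem (i := 2) (by norm_num) (by norm_num) (by omega), ?_⟩
    rw [missingEdges_succ (by norm_num), missingEdges_minimalLayers_two le_rfl]
    simp [minimalLayers, Finset.sum_range_succ]
    ring
  · rintro _ ⟨k, ⟨h0, h, h3, hsum⟩, rfl⟩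
    have h1 := h 1 le_rfl (by norm_num)
    simp only [Finset.sum_range_succ, Finset.sum_range_zero, h0, zero_add] at hsum
    rw [missingEdges_succ (by norm_num), missingEdges_two, ← hsum]
    simp only [Finset.sum_range_succ, Finset.sum_range_zero, h0, zero_add]
    nlinarith

theorem isLeast_missingEdges {n r : ℕ} (hr : 4 ≤ r) (hn : 2 * r ≤ n) :
    IsLeast (missingEdges r '' layerSizes n r)
      (2 * (n : ℝ) * ((r : ℝ) - 3) - 2 * (r : ℝ) ^ 2 + 6 * (r : ℝ) + 5) := by
  constructor
  · refine ⟨_, minimalLayers_mem (i := 2) (by norm_num) (by omega) hn, ?_⟩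
    obtain ⟨R, rfl⟩ : ∃ R, r = R + 1 := ⟨r - 1, by omega⟩
    rw [missingEdges_succ (by omega), missingEdges_minimalLayers_of_lt (by omega) (by omega),
      sum_minimalLayers (by norm_num) (by omega) (by omega), minimalLayers, if_pos (Or.inr rfl)]
    push_cast
    ring
  · rintro _ ⟨k, hk, rfl⟩
    exact le_missingEdges_of_mem_layerSizes (by omega) hk

theorem isLeast_minMissingEdges {n r : ℕ} (hr : 2 ≤ r) (hn : 2 * r ≤ n) :
    IsLeast (missingEdges r '' layerSizes n r) (minMissingEdges n r) ∧
      (r = 2 → minMissingEdges n r = 1) ∧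
      (r = 3 → minMissingEdges n r = (n : ℝ) - 1) ∧
      (4 ≤ r → minMissingEdges n r =
        2 * (n : ℝ) * ((r : ℝ) - 3) - 2 * (r : ℝ) ^ 2 + 6 * (r : ℝ) + 5) := by
  have key : ∀ {c : ℝ}, IsLeast (missingEdges r '' layerSizes n r) c →
      minMissingEdges n r = c := fun h => h.csInf_eq
  obtain rfl | rfl | hr : r = 2 ∨ r = 3 ∨ 4 ≤ r := by omega
  · have h := isLeast_missingEdges_two hn
    rw [key h]
    exact ⟨h, fun _ => rfl, by omega, by omega⟩
  · have h := isLeast_missingEdges_three hn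
    rw [key h]
    exact ⟨h, by omega, fun _ => rfl, by omega⟩
  · have h := isLeast_missingEdges hr hn
    rw [key h]
    exact ⟨h, by omega, by omega, fun _ => rfl⟩

theorem minMissingEdges_nonneg {n r : ℕ} (hr : 2 ≤ r) (hn : 2 * r ≤ n) :
    0 ≤ minMissingEdges n r := by
  have hn' : (2 : ℝ) * r ≤ n := by exact_mod_cast hn
  obtain ⟨-, h2, h3, h4⟩ := isLeast_minMissingEdges hr hn
  obtain rfl | rfl | hr : r = 2 ∨ r = 3 ∨ 4 ≤ r := by omega
  · rw [h2 rfl]; norm_num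
  · rw [h3 rfl]; push_cast at hn'; linarith
  · rw [h4 hr]
    have : (4 : ℝ) ≤ r := by exact_mod_cast hr
    nlinarith

/-- A graph with more than `M(n, r)` edges has enough edges to be connected. -/
theorem sub_two_le_edgeBound {n r : ℕ} (hr : 2 ≤ r) (hn : 2 * r ≤ n) :
    (n : ℝ) - 2 ≤ edgeBound n r := by
  have hn' : (2 : ℝ) * r ≤ n := by exact_mod_cast hn
  obtain ⟨-, h2, h3, h4⟩ := isLeast_minMissingEdges hr hn
  rw [edgeBound, if_neg (by omega), Nat.cast_choose_two]
  obtain rfl | rfl | hr : r = 2 ∨ r = 3 ∨ 4 ≤ r := by omega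
  · rw [h2 rfl]; push_cast at hn'; nlinarith
  · rw [h3 rfl]; push_cast at hn'; nlinarith
  · rw [h4 hr]
    have : (4 : ℝ) ≤ r := by exact_mod_cast hr
    nlinarith [sq_nonneg ((n : ℝ) - 2 * r)]

theorem edgeBound_le_choose {n r : ℕ} (hr : 1 ≤ r) (hn : 2 * r ≤ n) :
    edgeBound n r ≤ n.choose 2 := by
  rw [edgeBound]
  split_ifs with h
  · rw [Nat.cast_choose_two]
  · linarith [minMissingEdges_nonneg (n := n) (r := r) (by omega) hn]

/-! ### The extremal problem -/

theorem isGreatest_maxHyperbolicity {n m : ℕ} (h : (hyperbolicityValues n m).Nonempty) :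
    IsGreatest (hyperbolicityValues n m) (maxHyperbolicity n m) := by
  have hfin : (hyperbolicityValues n m).Finite := by
    refine (Set.finite_range fun G : {G : SimpleGraph (Fin n) // G.Connected} =>
      hyperbolicityConstant (MetricGraph G.1 G.2)).subset ?_
    rintro d ⟨G, hG, -, rfl⟩
    exact ⟨⟨G, hG⟩, rfl⟩
  exact ⟨h.csSup_mem hfin, fun d hd => le_csSup hfin.bddAbove hd⟩

theorem hyperbolicityValues_nonempty {n m : ℕ} (hn : 1 ≤ n) (h1 : n ≤ m + 1)
    (h2 : m ≤ n.choose 2) : (hyperbolicityValues n m).Nonempty := by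
  classical
  have : NeZero n := ⟨by omega⟩
  obtain ⟨T, -, hT⟩ := (SimpleGraph.connected_top (V := Fin n)).exists_isTree_le
  have hTcard := hT.card_edgeFinset
  rw [Fintype.card_fin] at hTcard
  have htop := SimpleGraph.card_edgeFinset_top_eq_card_choose_two (V := Fin n)
  rw [Fintype.card_fin] at htop
  obtain ⟨E, hE1, hE2, hE3⟩ := Finset.exists_subsuperset_card_eq
    (SimpleGraph.edgeFinset_mono (le_top : T ≤ ⊤)) (by omega : T.edgeFinset.card ≤ m)
    (h2.trans_eq htop.symm)
  have hE : (SimpleGraph.fromEdgeSet (E : Set (Sym2 (Fin n)))).edgeSet = E := by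
    rw [SimpleGraph.edgeSet_fromEdgeSet, sdiff_eq_left, Set.disjoint_left]
    intro e he hd
    exact SimpleGraph.not_isDiag_of_mem_edgeFinset (hE2 he) hd
  have hle : T ≤ SimpleGraph.fromEdgeSet (E : Set (Sym2 (Fin n))) := by
    rw [← SimpleGraph.edgeSet_subset_edgeSet, hE, ← SimpleGraph.coe_edgeFinset]
    exact_mod_cast hE1
  exact ⟨_, _, hT.connected.mono hle, by rw [hE, Set.ncard_coe_finset, hE3], rfl⟩

theorem hyperbolicityConstant_le_of_edgeBound_lt {n r : ℕ} (hr : 2 ≤ r) (hn : 2 * r ≤ n)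
    {G : SimpleGraph (Fin n)} (hG : G.Connected) (hm : edgeBound n r < G.edgeSet.ncard) :
    hyperbolicityConstant (MetricGraph G hG) ≤ (r : ℝ) / 2 := by
  classical
  refine hyperbolicityConstant_le_of_no_detour (ε := 1 / 4) (by positivity) (by norm_num)
    fun D γ Q h1 h2 h => ?_
  obtain ⟨w, hw, hfar⟩ := h.exists_layers hr h1 h2
  have h3 := hG.card_add_missingEdges_le w r
  have h4 := hG.layers_mem_layerSizes (by omega) hw hfar
  rw [Fintype.card_fin] at h3 h4
  have h5 := (isLeast_minMissingEdges hr hn).1.2 (Set.mem_image_of_mem _ h4)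
  rw [edgeBound, if_neg (by omega)] at hm
  linarith

theorem theoremt :
    -- `m = n - 1`
    (∀ n m : ℕ, 1 ≤ n → m + 1 = n →
      IsGreatest (hyperbolicityValues n m) (maxHyperbolicity n m) ∧
        maxHyperbolicity n m = 0) ∧
    -- `n ≤ m ≤ n + 3`
    (∀ n m : ℕ, 3 ≤ n → n ≤ m → m ≤ n + 3 → m ≤ n.choose 2 →
      IsGreatest (hyperbolicityValues n m) (maxHyperbolicity n m) ∧
        maxHyperbolicity n m = (n : ℝ) / 4) ∧
    -- `M(n, r) < m ≤ M(n, r - 1)`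
    (∀ n m r : ℕ, 2 ≤ r → 2 * r ≤ n →
      edgeBound n r < (m : ℝ) → (m : ℝ) ≤ edgeBound n (r - 1) →
      IsGreatest (hyperbolicityValues n m) (maxHyperbolicity n m) ∧
        maxHyperbolicity n m ≤ (r : ℝ) / 2) ∧
    -- the explicit form of `M(n, r)`
    (∀ n r : ℕ, 2 ≤ r → 2 * r ≤ n →
      IsLeast (missingEdges r '' layerSizes n r) (minMissingEdges n r) ∧
      edgeBound n r = (n.choose 2 : ℝ) - minMissingEdges n r ∧
      (r = 2 → minMissingEdges n r = 1) ∧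
      (r = 3 → minMissingEdges n r = (n : ℝ) - 1) ∧
      (4 ≤ r → minMissingEdges n r =
        2 * (n : ℝ) * ((r : ℝ) - 3) - 2 * (r : ℝ) ^ 2 + 6 * (r : ℝ) + 5)) := by
  refine ⟨fun n m hn hm => ?_, fun n m hn h1 h2 h3 => ?_, fun n m r hr hn h1 h2 => ?_,
    fun n r hr hn => ?_⟩
  · have hle : m ≤ n.choose 2 := by
      rw [← hm, Nat.choose_succ_succ, Nat.choose_one_right]
      exact Nat.le_add_right _ _
    have hB := isGreatest_maxHyperbolicity (hyperbolicityValues_nonempty hn (by omega) hle)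
    refine ⟨hB, ?_⟩
    obtain ⟨G, hG, hcard, e⟩ := hB.1
    have hT : G.IsTree := SimpleGraph.isTree_iff_connected_and_card.2
      ⟨hG, by rw [Nat.card_coe_set_eq, hcard, hm, Nat.card_fin]⟩
    rw [e, MetricGraph.hyperbolicityConstant_eq_zero_of_isAcyclic hT.isAcyclic]
  · have hB := isGreatest_maxHyperbolicity (hyperbolicityValues_nonempty (by omega) (by omega) h3)
    refine ⟨hB, le_antisymm ?_ ?_⟩
    · obtain ⟨G, hG, -, e⟩ := hB.1
      rw [e]
      simpa using MetricGraph.hyperbolicityConstant_le_card_div_four (hG := hG)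
        (by rw [Fintype.card_fin]; omega)
    · obtain ⟨G, hG, hcard, hle⟩ := MetricGraph.exists_card_div_four_le hn h1 h2 h3
      exact hle.trans (hB.2 ⟨G, hG, hcard, rfl⟩)
  · have hlow : n ≤ m + 1 := by
      have := sub_two_le_edgeBound hr hn
      have : (n : ℝ) < m + 2 := by linarith
      have : n < m + 2 := by exact_mod_cast this
      omega
    have hup : m ≤ n.choose 2 := by
      exact_mod_cast h2.trans (edgeBound_le_choose (by omega) (by omega))
    have hB := isGreatest_maxHyperbolicity (hyperbolicityValues_nonempty (by omega) hlow hup)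
    refine ⟨hB, ?_⟩
    obtain ⟨G, hG, hcard, e⟩ := hB.1
    rw [e]
    exact hyperbolicityConstant_le_of_edgeBound_lt hr hn hG (by rwa [hcard])
  · obtain ⟨h1, h2⟩ := isLeast_minMissingEdges hr hn
    exact ⟨h1, by rw [edgeBound, if_neg (by omega)], h2⟩
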